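/- Let $\mathcal X$ be a measurable space, $P$ a probability law on $\mathcal X\times\{0,1\}$, $\widehat\eta:\mathcal X\to[0,1]$ and $T:\mathcal X\times[0,1]\to\mathbb R$ measurable, and let $n\ge 0$ and $M,K,L$ be nonnegative integers with $M+1=KL$. Let $(X_j,Y_j)_{j=1}^n$ be i.i.d. from $P$. Independently for each $j$, and given $(X_j,Y_j)$, draw $W_j\sim\mathsf{Unif}[0,\widehat\eta(X_j)]$ if $Y_j=1$ and $W_j\sim\mathsf{Unif}[\widehat\eta(X_j),1]$ if $Y_j=0$ (a point mass if the interval is a point), and draw counterfeits $\widetilde W_j^{(1)},\dots,\widetilde W_j^{(M)}$ i.i.d. from $\mathsf{Unif}[0,1]$, independent of $(X_j,Y_j,W_j)$. Let $$R_j=1+\sum_{i=1}^M \mathbb 1\{T(X_j,W_j)\ge T(X_j,\widetilde W_j^{(i)})\},$$ give sample $j$ the label $\ell\in\{1,\dots,L\}$ if $(\ell-1)K+1\le R_j\le K\ell$, and let $V_\ell$ be the number of samples with label $\ell$. Then $\mathbf V_{n,L}=(V_1,\dots,V_L)$ has the multinomial distribution with $n$ trials and probabilities $p_1,\dots,p_L$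 ($p_\ell\ge0$, $\sum_\ell p_\ell=1$), where $p_\ell$ is the probability that a single sample receives the label $\ell$ (so $p_\ell$ does not depend on $n$). Moreover, let $(X,Y,W)$ have the law of one sample, let $\widetilde W\sim\mathsf{Unif}[0,1]$ be independent of it, and put $F_o(t;x)=\mathbb P(T(X,W)\le t\mid X=x)$, $F_c(t;x)=\mathbb P(T(X,\widetilde W)\le t\mid X=x)$. Assume that for almost every $x$ (with respect to the law of $X$) both $F_o(\cdot\,;x)$ and $F_c(\cdot\,;x)$ have Lebesgue densities, and that the measure on $[0,1]$ with distribution function $\omega(u;x)=F_o(F_c^{-1}(u;x);x)$, $0<u<1$, where $F_c^{-1}(u;x)=\inf\{t: F_c(t;x)\ge u\}$, is absolutely continuous with respect to Lebesgue measure. Let $f$ be a real function that is convex and continuous on $[0,\infty)$, and for laws with Lebesgue densities $p,q$ let $D_f(p\|q)=\int q\,f(p/q)\,dt$, with integrand $0$ where $q=0$. Then $$\frac1L\sum_{\ell=1}^L f(Lp_\ell)\le \mathbb E\big[D_f\big(\mathcal L(T(X,W)|X)\,\|\,\mathcal L(T(X,\widetilde W)|X)\big)\big]\le \mathbb E\big[D_f\big(\mathcal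 L_{W|X}\,\|\,\mathcal L_{\widetilde W|X}\big)\big]=\mathbb E\big[D_f\big(\mathcal L_{W|X}\,\|\,\mathsf{Unif}[0,1]\big)\big],$$ where the integrals and expectations are extended-real valued (integral of the positive part minus integral of the negative part; they may equal $+\infty$). -/

import Mathlib

open MeasureTheory ProbabilityTheory

namespace Grasp

noncomputable section

/-! ### Extended-real integrals and `f`-divergences -/

/-- The integral of an extended-real function: integral of the positive part minus integral of the
negative part, with values in `[-∞, ∞]` (and value `-∞` when both parts have infinite integral). -/
def eintegral {α : Type*} [MeasurableSpace α] (μ : Measure α) (g : α → EReal) : EReal :=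
  ((∫⁻ x, (g x).toENNReal ∂μ : ENNReal) : EReal) - ((∫⁻ x, (-g x).toENNReal ∂μ : ENNReal) : EReal)

/-- The `f`-divergence `∫ q f(p / q) dρ` of two densities `p`, `q` with respect to `ρ`
(the integrand is `0` where `q` vanishes). -/
def fDivDensity {α : Type*} [MeasurableSpace α] (f : ℝ → ℝ) (ρ : Measure α) (p q : α → ℝ) : EReal :=
  eintegral ρ fun t => ((q t * f (p t / q t) : ℝ) : EReal)

/-- The Lebesgue density of a measure. -/
def density {α : Type*} [MeasureSpace α] (P : Measure α) (t : α) : ℝ :=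
  (P.rnDeriv volume t).toReal

/-- The `f`-divergence `D_f(P ‖ Q)` of two laws that have Lebesgue densities. -/
def fDiv {α : Type*} [MeasureSpace α] (f : ℝ → ℝ) (P Q : Measure α) : EReal :=
  fDivDensity f volume (density P) (density Q)

/-! ### The sampling scheme -/

/-- The uniform law on `[a, b] ⊆ [0, 1]`, the point mass at `a` when the interval is degenerate. -/
def unifIcc (a b : unitInterval) : Measure unitInterval :=
  if a < b then (volume : Measure unitInterval)[|Set.Icc a b] else Measure.dirac a

/-- The uniform law on `[0, 1]`. -/
def unif01 : Measure unitInterval := volume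

instance : IsProbabilityMeasure unif01 := inferInstanceAs (IsProbabilityMeasure volume)

lemma measurable_unifIcc :
    Measurable fun p : unitInterval × unitInterval => unifIcc p.1 p.2 := by
  refine Measure.measurable_of_measurable_coe _ fun s hs => ?_
  have h1 : ∀ t : Set unitInterval, MeasurableSet t →
      Measurable fun p : unitInterval × unitInterval =>
        (volume : Measure unitInterval) (Set.Icc p.1 p.2 ∩ t) := by
    intro t ht
    have hm : MeasurableSet {z : (unitInterval × unitInterval) × unitInterval |
        (z.1.1 ≤ z.2 ∧ z.2 ≤ z.1.2) ∧ z.2 ∈ t} := by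
      refine MeasurableSet.inter (MeasurableSet.inter ?_ ?_) (measurable_snd ht)
      · exact measurableSet_le (by fun_prop) (by fun_prop)
      · exact measurableSet_le (by fun_prop) (by fun_prop)
    exact measurable_measure_prodMk_left hm
  have h2 : Measurable fun p : unitInterval × unitInterval =>
      (volume : Measure unitInterval) (Set.Icc p.1 p.2) := by
    simpa using h1 Set.univ MeasurableSet.univ
  have h3 : (fun p : unitInterval × unitInterval => unifIcc p.1 p.2 s) = fun p =>
      if p.1 < p.2 then ((volume : Measure unitInterval) (Set.Icc p.1 p.2))⁻¹ *
        (volume : Measure unitInterval) (Set.Icc p.1 p.2 ∩ s)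
      else s.indicator 1 p.1 := by
    funext p
    unfold unifIcc
    split_ifs
    · rw [cond_apply measurableSet_Icc]
    · rw [Measure.dirac_apply' _ hs]
  rw [h3]
  exact Measurable.ite (measurableSet_lt measurable_fst measurable_snd) (h2.inv.mul (h1 s hs))
    ((measurable_one.indicator hs).comp measurable_fst)

instance (a b : unitInterval) : IsProbabilityMeasure (unifIcc a b) := by
  unfold unifIcc
  split_ifs with h
  · refine cond_isProbabilityMeasure ?_
    rw [unitInterval.volume_Icc]
    simpa using h
  · infer_instance

variable {𝒳 : Type*} [MeasurableSpace 𝒳]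

/-- The conditional law of `w` given `(x, y)`: uniform on `[0, η̂(x)]` if `y = 1` (`true`), uniform
on `[η̂(x), 1]` if `y = 0` (`false`). -/
def wKernel (ηhat : 𝒳 → unitInterval) (hη : Measurable ηhat) : Kernel (𝒳 × Bool) unitInterval where
  toFun z := if z.2 = true then unifIcc 0 (ηhat z.1) else unifIcc (ηhat z.1) 1
  measurable' := by
    refine Measurable.ite (measurable_snd (measurableSet_singleton true)) ?_ ?_
    · exact measurable_unifIcc.comp
        (measurable_const.prodMk (hη.comp measurable_fst))
    · exact measurable_unifIcc.comp
        ((hη.comp measurable_fst).prodMk measurable_const)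

instance (ηhat : 𝒳 → unitInterval) (hη : Measurable ηhat) : IsMarkovKernel (wKernel ηhat hη) := by
  refine ⟨fun z => ?_⟩
  change IsProbabilityMeasure (if z.2 = true then unifIcc 0 (ηhat z.1) else unifIcc (ηhat z.1) 1)
  split_ifs <;> infer_instance

/-- The joint law of `((x, y), w)` when `(x, y)` has law `P`. -/
def lawXYW (P : Measure (𝒳 × Bool)) (ηhat : 𝒳 → unitInterval) (hη : Measurable ηhat) :
    Measure ((𝒳 × Bool) × unitInterval) :=
  P.compProd (wKernel ηhat hη)

/-- The joint law of `(((x, y), w), (w̃⁽¹⁾, …, w̃⁽ᴹ⁾))`: a labelled data point, its sampled value and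
`M` independent uniform counterfeits. -/
def sampleLaw (P : Measure (𝒳 × Bool)) (ηhat : 𝒳 → unitInterval) (hη : Measurable ηhat) (M : ℕ) :
    Measure (((𝒳 × Bool) × unitInterval) × (Fin M → unitInterval)) :=
  (lawXYW P ηhat hη).prod (Measure.pi fun _ => unif01)

/-! ### The algorithm -/

/-- The rank of `T(x, w)` among itself and the counterfeit scores `T(x, w̃⁽ⁱ⁾)`. -/
def rank {M : ℕ} (T : 𝒳 × unitInterval → ℝ) (x : 𝒳) (w : unitInterval)
    (wt : Fin M → unitInterval) : ℕ :=
  1 + (Finset.univ.filter fun i => T (x, wt i) ≤ T (x, w)).card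

/-- The label `ℓ` is assigned to the sample. Labels are numbered from `0`, so that the
condition `(ℓ - 1) K + 1 ≤ R ≤ K ℓ` for `ℓ = 1, …, L` reads `ℓ K + 1 ≤ R ≤ K (ℓ + 1)` for
`ℓ = 0, …, L - 1`. -/
def HasLabel {M : ℕ} (T : 𝒳 × unitInterval → ℝ) (K ℓ : ℕ) (x : 𝒳) (w : unitInterval)
    (wt : Fin M → unitInterval) : Prop :=
  ℓ * K + 1 ≤ rank T x w wt ∧ rank T x w wt ≤ K * (ℓ + 1)

open Classical in
/-- The output `[V_1, …, V_L]` on data points `x_j`, sampled values `w_j` and counterfeits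
`w̃_j⁽ⁱ⁾`: the number of samples carrying each label. -/
def labelCounts {n M : ℕ} (T : 𝒳 × unitInterval → ℝ) (K L : ℕ) (x : Fin n → 𝒳)
    (w : Fin n → unitInterval) (wt : Fin n → Fin M → unitInterval) : Fin L → ℕ :=
  fun ℓ => (Finset.univ.filter fun j => HasLabel T K ℓ (x j) (w j) (wt j)).card

/-- The probability that one sample receives the label `ℓ`. -/
def labelProb (P : Measure (𝒳 × Bool)) (ηhat : 𝒳 → unitInterval) (hη : Measurable ηhat)
    (T : 𝒳 × unitInterval → ℝ) (M K ℓ : ℕ) : ℝ :=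
  (sampleLaw P ηhat hη M).real {z | HasLabel T K ℓ z.1.1.1 z.1.2 z.2}

open Classical in
/-- The multinomial law with `n` trials and outcome probabilities `p`: mass
`n! / (v_1! ⋯ v_L!) ∏ p_ℓ ^ v_ℓ` at each `v` with `∑ v_ℓ = n`, and no mass elsewhere. -/
def multinomialLaw {L : ℕ} (n : ℕ) (p : Fin L → ℝ) : Measure (Fin L → ℕ) :=
  Measure.sum fun v : Fin L → ℕ =>
    ENNReal.ofReal (if ∑ ℓ, v ℓ = n then
      (Nat.multinomial Finset.univ v : ℝ) * ∏ ℓ, p ℓ ^ v ℓ else 0) • Measure.dirac v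

/-! ### Conditional laws -/

/-- The joint law of `(((x, y), w), w̃)` with one independent uniform counterfeit. -/
def popLaw (P : Measure (𝒳 × Bool)) (ηhat : 𝒳 → unitInterval) (hη : Measurable ηhat) :
    Measure (((𝒳 × Bool) × unitInterval) × unitInterval) :=
  (lawXYW P ηhat hη).prod unif01

instance (P : Measure (𝒳 × Bool)) [IsProbabilityMeasure P] (ηhat : 𝒳 → unitInterval)
    (hη : Measurable ηhat) : IsProbabilityMeasure (popLaw P ηhat hη) := by
  unfold popLaw lawXYW
  infer_instance

section Conditional

variable (P : Measure (𝒳 × Bool)) [IsProbabilityMeasure P] (ηhat : 𝒳 → unitInterval)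
  (hη : Measurable ηhat) (T : 𝒳 × unitInterval → ℝ)

/-- The conditional law of `W` given `X`. -/
def condW : Kernel 𝒳 unitInterval :=
  condDistrib (fun z => z.1.2) (fun z => z.1.1.1) (popLaw P ηhat hη)

/-- The conditional law of the counterfeit `W̃` given `X`. -/
def condWt : Kernel 𝒳 unitInterval :=
  condDistrib (fun z => z.2) (fun z => z.1.1.1) (popLaw P ηhat hη)

/-- The conditional law of `T(X, W)` given `X`. -/
def condTW : Kernel 𝒳 ℝ :=
  condDistrib (fun z => T (z.1.1.1, z.1.2)) (fun z => z.1.1.1) (popLaw P ηhat hη)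

/-- The conditional law of `T(X, W̃)` given `X`. -/
def condTWt : Kernel 𝒳 ℝ :=
  condDistrib (fun z => T (z.1.1.1, z.2)) (fun z => z.1.1.1) (popLaw P ηhat hη)

/-- `F_o(t; x) = ℙ(T(X, W) ≤ t | X = x)`. -/
def Fo (t : ℝ) (x : 𝒳) : ℝ := (condTW P ηhat hη T x).real (Set.Iic t)

/-- `F_c(t; x) = ℙ(T(X, W̃) ≤ t | X = x)`. -/
def Fc (t : ℝ) (x : 𝒳) : ℝ := (condTWt P ηhat hη T x).real (Set.Iic t)

/-- The quantile function `F_c⁻¹(u; x) = inf {t | u ≤ F_c(t; x)}`, used for `0 < u < 1`. -/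
def FcInv (u : ℝ) (x : 𝒳) : ℝ := sInf {t | u ≤ Fc P ηhat hη T t x}

/-- For almost every `x`, the conditional laws of `T(X, W)` and of `T(X, W̃)` given `X = x` have
Lebesgue densities, and the measure on `[0, 1]` with distribution function
`ω(u; x) = F_o(F_c⁻¹(u; x); x)` is absolutely continuous. -/
structure ScoreAssumption : Prop where
  density_o : ∀ᵐ x ∂P.fst, condTW P ηhat hη T x ≪ volume
  density_c : ∀ᵐ x ∂P.fst, condTWt P ηhat hη T x ≪ volume
  omega_ac : ∀ᵐ x ∂P.fst, ∃ ν : Measure ℝ, IsProbabilityMeasure ν ∧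
    ν ≪ volume.restrict (Set.Icc 0 1) ∧
    ∀ u ∈ Set.Ioo (0 : ℝ) 1, ν.real (Set.Iic u) = Fo P ηhat hη T (FcInv P ηhat hη T u x) x

end Conditional

end

end Grasp

namespace Grasp

/-! ### The multinomial law -/

/-! Since `M + 1 = K * L`, the possible ranks split into `L` blocks of length `K`, so each sample
carries exactly one label. The labels are i.i.d. letters, and every word with letter counts `v` has
probability `∏ p ℓ ^ v ℓ`. Counting these words gives the multinomial law.

For the inequalities, subtract an affine minorant from `f`. What remains is a nonnegative convex
`h`, and the affine part contributes the same constant `c + c'` to the label average and to each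
conditional divergence, because all the laws have mass one. Only integrals of `h` in `[0, ∞]` have
to be compared, and each comparison is Jensen's inequality.

Average first over `x`: `p ℓ` is the mean of the conditional label probabilities
(`ofReal_labelProb_le_lintegral`). At fixed `x` the label is a randomized function of the score `T
(x, w)` alone. If `w` were itself uniform, its score would be exchangeable with the counterfeit
scores and almost surely untied, so each label would have probability `1 / L`
(`lintegral_hasLabel_unif`). Data processing for this randomization (`sum_ofReal_le_divEnergy`)
gives the first inequality; data processing for the map `T (x, ·)` (`divEnergy_map_le`) gives the
second.

Both need the law of `W` given `x` to be absolutely continuous. Its only possible singular part is a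
pair of atoms at the endpoints, from degenerate intervals, and an atom of `W` would be an atom of
`T(X, W)`, which has a density. -/

/-- The number of occurrences of each letter in a word. -/
def letterCounts {ι κ : Type*} [Fintype ι] [DecidableEq κ] (c : ι → κ) (ℓ : κ) : ℕ :=
  (Finset.univ.filter fun j => c j = ℓ).card

lemma prod_comp_eq_prod_pow_letterCounts {ι κ R : Type*} [Fintype ι] [Fintype κ] [DecidableEq κ]
    [CommMonoid R] (c : ι → κ) (a : κ → R) :
    ∏ j, a (c j) = ∏ ℓ, a ℓ ^ letterCounts c ℓ := by
  rw [← Finset.prod_fiberwise (s := Finset.univ) (g := c)]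
  refine Finset.prod_congr rfl fun ℓ _ => ?_
  rw [Finset.prod_congr rfl (g := fun _ => a ℓ)]
  · simp [letterCounts]
  · intro j hj
    rw [(Finset.mem_filter.1 hj).2]

lemma coeff_prod_X_pow_univ {κ : Type*} [Fintype κ] [DecidableEq κ] (u v : κ → ℕ) :
    (∏ ℓ, (MvPolynomial.X ℓ : MvPolynomial κ ℕ) ^ u ℓ).coeff (Finsupp.equivFunOnFinite.symm v) =
      if u = v then 1 else 0 := by
  have : (∏ ℓ, (MvPolynomial.X ℓ : MvPolynomial κ ℕ) ^ u ℓ) =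
      MvPolynomial.monomial (Finsupp.equivFunOnFinite.symm u) 1 := by
    rw [MvPolynomial.monomial_eq, Finsupp.prod_fintype _ _ (by simp)]
    simp
  rw [this, MvPolynomial.coeff_monomial]
  simp

/-- The number of words of length `n` with prescribed letter counts. -/
lemma card_letterCounts_eq {κ : Type*} [Fintype κ] [DecidableEq κ] (n : ℕ) (v : κ → ℕ) :
    (Finset.univ.filter fun c : Fin n → κ => letterCounts c = v).card =
      if ∑ ℓ, v ℓ = n then Nat.multinomial Finset.univ v else 0 := by
  -- Expand the power of a sum of indeterminates in two ways, over words and by the multinomial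
  -- theorem; the coefficient at `v` is the desired count.
  have h1 : (∑ ℓ, (MvPolynomial.X ℓ : MvPolynomial κ ℕ)) ^ n =
      ∑ c : Fin n → κ, ∏ ℓ, MvPolynomial.X ℓ ^ letterCounts c ℓ := by
    rw [Fintype.sum_pow]
    exact Finset.sum_congr rfl fun c _ => prod_comp_eq_prod_pow_letterCounts c _
  rw [Finset.sum_pow_eq_sum_piAntidiag] at h1
  have h2 := congrArg (MvPolynomial.coeff (Finsupp.equivFunOnFinite.symm v)) h1
  simp_rw [MvPolynomial.coeff_sum, ← MvPolynomial.C_eq_coe_nat, MvPolynomial.coeff_C_mul,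
    coeff_prod_X_pow_univ] at h2
  rw [Finset.card_filter, ← h2]
  simp [Finset.mem_piAntidiag]

/-- By independence the probability of a word depends only on its letter counts, so the mass at `v`
is the number of such words times a common value. -/
lemma hasLaw_letterCounts {Ω : Type*} [MeasurableSpace Ω] {μ : Measure Ω} [IsProbabilityMeasure μ]
    {n L : ℕ} {c : Fin n → Ω → Fin L} (hc : ∀ j, AEMeasurable (c j) μ) (hind : iIndepFun c μ)
    {p : Fin L → ℝ} (hp : ∀ ℓ, 0 ≤ p ℓ) (hcp : ∀ j ℓ, μ.map (c j) {ℓ} = ENNReal.ofReal (p ℓ)) :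
    HasLaw (fun ω => letterCounts fun j => c j ω) (multinomialLaw n p) μ := by
  have hcm : AEMeasurable (fun ω j => c j ω) μ := aemeasurable_pi_lambda _ hc
  have hl : Measurable (letterCounts : (Fin n → Fin L) → Fin L → ℕ) := measurable_of_countable _
  refine ⟨hl.comp_aemeasurable hcm, ?_⟩
  have hmap : μ.map (fun ω => letterCounts fun j => c j ω) =
      (Measure.pi fun j => μ.map (c j)).map letterCounts := by
    rw [← (iIndepFun_iff_map_fun_eq_pi_map hc).1 hind,
      AEMeasurable.map_map_of_aemeasurable hl.aemeasurable hcm]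
    rfl
  rw [hmap]
  have hprob : ∀ j, IsProbabilityMeasure (μ.map (c j)) :=
    fun j => Measure.isProbabilityMeasure_map (hc j)
  refine Measure.ext_of_singleton fun v => ?_
  rw [Measure.map_apply hl (measurableSet_singleton v)]
  have hset : letterCounts ⁻¹' {v} =
      ((Finset.univ.filter fun c : Fin n → Fin L => letterCounts c = v :
        Finset (Fin n → Fin L)) : Set (Fin n → Fin L)) := by
    ext c; simp
  rw [hset, ← MeasureTheory.sum_measure_singleton]
  have hterm : ∀ d ∈ (Finset.univ.filter fun c : Fin n → Fin L => letterCounts c = v),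
      (Measure.pi fun j => μ.map (c j)) {d} = ENNReal.ofReal (∏ ℓ, p ℓ ^ v ℓ) := by
    intro d hd
    rw [Measure.pi_singleton, Finset.prod_congr rfl (fun j _ => hcp j (d j)),
      ← ENNReal.ofReal_prod_of_nonneg (fun j _ => hp _), prod_comp_eq_prod_pow_letterCounts d p,
      (Finset.mem_filter.1 hd).2]
  rw [Finset.sum_congr rfl hterm, Finset.sum_const, card_letterCounts_eq, multinomialLaw,
    Measure.sum_apply _ (measurableSet_singleton v), tsum_eq_single v]
  · simp only [Measure.smul_apply, Measure.dirac_apply_of_mem (Set.mem_singleton v), smul_eq_mul,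
      mul_one, nsmul_eq_mul]
    split_ifs
    · rw [ENNReal.ofReal_mul (by positivity), ENNReal.ofReal_natCast]
    · simp
  · intro w hw
    simp [Measure.smul_apply, hw]

/-! ### Labels and ranks -/

section Label

variable {𝒳 : Type*}

lemma rank_le {M : ℕ} (T : 𝒳 × unitInterval → ℝ) (x : 𝒳) (w : unitInterval)
    (wt : Fin M → unitInterval) : rank T x w wt ≤ M + 1 := by
  have h := Finset.card_filter_le (Finset.univ : Finset (Fin M))
    (fun i => T (x, wt i) ≤ T (x, w))
  rw [Finset.card_univ, Fintype.card_fin] at h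
  unfold rank
  omega

lemma one_le_rank {M : ℕ} (T : 𝒳 × unitInterval → ℝ) (x : 𝒳) (w : unitInterval)
    (wt : Fin M → unitInterval) : 1 ≤ rank T x w wt := by
  unfold rank
  omega

/-- The label of a sample, as a function of its rank. -/
noncomputable def rankLabel {M K L : ℕ} (hKL : M + 1 = K * L) (T : 𝒳 × unitInterval → ℝ) (x : 𝒳)
    (w : unitInterval) (wt : Fin M → unitInterval) : Fin L :=
  ⟨(rank T x w wt - 1) / K, by
    refine Nat.div_lt_of_lt_mul ?_
    have := rank_le T x w wt
    have := one_le_rank T x w wt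
    omega⟩

lemma hasLabel_iff {M K L : ℕ} (hKL : M + 1 = K * L) (T : 𝒳 × unitInterval → ℝ) (x : 𝒳)
    (w : unitInterval) (wt : Fin M → unitInterval) (ℓ : Fin L) :
    HasLabel T K ℓ x w wt ↔ rankLabel hKL T x w wt = ℓ := by
  have hK : 0 < K := by
    rcases Nat.eq_zero_or_pos K with h | h
    · simp [h] at hKL
    · exact h
  have := one_le_rank T x w wt
  rw [Fin.ext_iff, rankLabel, HasLabel, Nat.div_eq_iff hK, mul_add, mul_comm K, mul_one]
  omega

variable [MeasurableSpace 𝒳]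

lemma measurable_rank {M : ℕ} {T : 𝒳 × unitInterval → ℝ} (hT : Measurable T) :
    Measurable fun z : (𝒳 × unitInterval) × (Fin M → unitInterval) =>
      rank T z.1.1 z.1.2 z.2 := by
  unfold rank
  simp_rw [Finset.card_filter]
  refine measurable_const.add (Finset.measurable_sum _ fun i _ => ?_)
  refine Measurable.ite (measurableSet_le ?_ ?_) measurable_const measurable_const
  · exact hT.comp (by fun_prop)
  · exact hT.comp (by fun_prop)

lemma measurable_rankLabel {M K L : ℕ} (hKL : M + 1 = K * L) {T : 𝒳 × unitInterval → ℝ}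
    (hT : Measurable T) :
    Measurable fun z : (𝒳 × unitInterval) × (Fin M → unitInterval) =>
      rankLabel hKL T z.1.1 z.1.2 z.2 := by
  refine measurable_to_countable' fun ℓ => ?_
  have : (fun z : (𝒳 × unitInterval) × (Fin M → unitInterval) =>
      rankLabel hKL T z.1.1 z.1.2 z.2) ⁻¹' {ℓ} =
      (fun z => rank T z.1.1 z.1.2 z.2) ⁻¹' {r | (r - 1) / K = ℓ} := by
    ext z
    simp [rankLabel, Fin.ext_iff]
  rw [this]
  exact measurable_rank hT (MeasurableSet.of_discrete)

instance (P : Measure (𝒳 × Bool)) [IsProbabilityMeasure P] (ηhat : 𝒳 → unitInterval)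
    (hη : Measurable ηhat) (M : ℕ) : IsProbabilityMeasure (sampleLaw P ηhat hη M) := by
  unfold sampleLaw lawXYW
  infer_instance

variable (P : Measure (𝒳 × Bool)) [IsProbabilityMeasure P] (ηhat : 𝒳 → unitInterval)
  (hη : Measurable ηhat)

lemma measurable_rankLabel_sample {M K L : ℕ} (hKL : M + 1 = K * L) {T : 𝒳 × unitInterval → ℝ}
    (hT : Measurable T) :
    Measurable fun z : ((𝒳 × Bool) × unitInterval) × (Fin M → unitInterval) =>
      rankLabel hKL T z.1.1.1 z.1.2 z.2 :=
  (measurable_rankLabel hKL hT).comp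
    (f := fun z : ((𝒳 × Bool) × unitInterval) × (Fin M → unitInterval) =>
      ((z.1.1.1, z.1.2), z.2)) (by fun_prop)

lemma ofReal_labelProb {M K L : ℕ} (hKL : M + 1 = K * L) {T : 𝒳 × unitInterval → ℝ}
    (hT : Measurable T) (ℓ : Fin L) :
    ENNReal.ofReal (labelProb P ηhat hη T M K ℓ) =
      (sampleLaw P ηhat hη M).map
        (fun z => rankLabel hKL T z.1.1.1 z.1.2 z.2) {ℓ} := by
  rw [Measure.map_apply (measurable_rankLabel_sample hKL hT) (measurableSet_singleton ℓ),
    labelProb, Measure.real, ENNReal.ofReal_toReal (measure_ne_top _ _)]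
  simp_rw [hasLabel_iff hKL]
  rfl

/-- The labels exhaust all ranks because `M + 1 = K * L`, so the `p ℓ` are the masses of the law of
an `L`-valued variable. -/
lemma sum_labelProb {M K L : ℕ} (hKL : M + 1 = K * L) {T : 𝒳 × unitInterval → ℝ}
    (hT : Measurable T) :
    ∑ ℓ : Fin L, labelProb P ηhat hη T M K ℓ = 1 := by
  have hnn : ∀ ℓ : Fin L, 0 ≤ labelProb P ηhat hη T M K ℓ := fun _ => measureReal_nonneg
  have := Measure.isProbabilityMeasure_map (μ := sampleLaw P ηhat hη M)
    (measurable_rankLabel_sample hKL hT).aemeasurable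
  rw [← ENNReal.ofReal_eq_one, ENNReal.ofReal_sum_of_nonneg fun ℓ _ => hnn ℓ]
  simp_rw [ofReal_labelProb P ηhat hη hKL hT]
  rw [MeasureTheory.sum_measure_singleton, Finset.coe_univ, measure_univ]

lemma hasLaw_labelCounts {n M K L : ℕ} (hKL : M + 1 = K * L) {T : 𝒳 × unitInterval → ℝ}
    (hT : Measurable T) {Ω : Type*} [MeasurableSpace Ω] {μ : Measure Ω} [IsProbabilityMeasure μ]
    {X : Fin n → Ω → 𝒳} {Y : Fin n → Ω → Bool} {W : Fin n → Ω → unitInterval}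
    {Wt : Fin n → Fin M → Ω → unitInterval}
    (hlaw : ∀ j, HasLaw (fun ω => (((X j ω, Y j ω), W j ω), fun i => Wt j i ω))
      (sampleLaw P ηhat hη M) μ)
    (hindep : iIndepFun (fun j ω => (((X j ω, Y j ω), W j ω), fun i => Wt j i ω)) μ) :
    HasLaw (fun ω => labelCounts T K L (fun j => X j ω) (fun j => W j ω)
      (fun j i => Wt j i ω))
      (multinomialLaw n fun ℓ : Fin L => labelProb P ηhat hη T M K ℓ) μ := by
  let G : ((𝒳 × Bool) × unitInterval) × (Fin M → unitInterval) → Fin L :=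
    fun z => rankLabel hKL T z.1.1.1 z.1.2 z.2
  have hm : Measurable G := measurable_rankLabel_sample hKL hT
  have hV : (fun ω => labelCounts T K L (fun j => X j ω) (fun j => W j ω)
      (fun j i => Wt j i ω)) =
      fun ω => letterCounts fun j => G (((X j ω, Y j ω), W j ω), fun i => Wt j i ω) := by
    funext ω ℓ
    simp only [labelCounts, letterCounts, hasLabel_iff hKL, G]
  rw [hV]
  refine hasLaw_letterCounts (fun j => hm.comp_aemeasurable (hlaw j).aemeasurable)
    (hindep.comp (fun _ => G) fun _ => hm) (fun _ => measureReal_nonneg) fun j ℓ => ?_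
  have h := AEMeasurable.map_map_of_aemeasurable hm.aemeasurable (hlaw j).aemeasurable
  rw [ofReal_labelProb P ηhat hη hKL hT, ← (hlaw j).map_eq]
  exact congrArg (fun ν : Measure (Fin L) => ν {ℓ}) h.symm

end Label

/-! ### Ranks of exchangeable scores -/

section Exchangeable

variable {α : Type*} {ι : Type*} [Fintype ι]

/-- The rank of the score of `v i` among the scores of all coordinates of `v`. -/
noncomputable def scoreRank (S : α → ℝ) (v : ι → α) (i : ι) : ℕ :=
  (Finset.univ.filter fun j => S (v j) ≤ S (v i)).card

/-- A strictly larger score has a strictly larger rank, since it also counts itself. Without ties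
the rank is therefore injective, into a set of the same cardinality. -/
lemma bijOn_scoreRank (S : α → ℝ) (v : ι → α) (hv : Function.Injective fun i => S (v i)) :
    Set.BijOn (scoreRank S v) (Finset.univ : Finset ι) (Finset.Icc 1 (Fintype.card ι)) := by
  have hmaps : Set.MapsTo (scoreRank S v) (Finset.univ : Finset ι)
      (Finset.Icc 1 (Fintype.card ι)) := by
    intro i _
    simp only [Finset.coe_Icc, Set.mem_Icc]
    refine ⟨Finset.card_pos.2 ⟨i, by simp⟩, ?_⟩
    exact (Finset.card_le_univ _)
  have hlt : ∀ i j, S (v i) < S (v j) → scoreRank S v i < scoreRank S v j := by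
    intro i j hij
    refine Finset.card_lt_card ⟨?_, ?_⟩
    · intro k hk
      simp only [Finset.mem_filter, Finset.mem_univ, true_and] at hk ⊢
      exact hk.trans hij.le
    · intro hsub
      have : j ∈ Finset.univ.filter fun k => S (v k) ≤ S (v i) := hsub (by simp)
      simp only [Finset.mem_filter, Finset.mem_univ, true_and] at this
      exact absurd hij this.not_gt
  have hinj : Set.InjOn (scoreRank S v) (Finset.univ : Finset ι) := by
    intro i _ j _ hij
    rcases lt_trichotomy (S (v i)) (S (v j)) with h | h | h
    · exact absurd hij (hlt i j h).ne
    · exact hv h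
    · exact absurd hij (hlt j i h).ne'
  exact ⟨hmaps, hinj, Finset.surjOn_of_injOn_of_card_le _ hmaps hinj (by simp)⟩

lemma card_scoreRank_mem (S : α → ℝ) (v : ι → α) (hv : Function.Injective fun i => S (v i))
    {A : Finset ℕ} (hA : A ⊆ Finset.Icc 1 (Fintype.card ι)) :
    (Finset.univ.filter fun i => scoreRank S v i ∈ A).card = A.card := by
  obtain ⟨-, hinj, hsurj⟩ := bijOn_scoreRank S v hv
  refine Finset.card_bij (fun i _ => scoreRank S v i) (fun i hi => (Finset.mem_filter.1 hi).2)
    (fun i _ j _ h => hinj (by simp) (by simp) h) fun r hr => ?_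
  obtain ⟨i, -, hi⟩ := hsurj (Finset.mem_coe.2 (hA hr))
  exact ⟨i, by simpa [hi] using hr, hi⟩

variable [MeasurableSpace α] {S : α → ℝ}

lemma measurable_scoreRank (hS : Measurable S) (i : ι) :
    Measurable fun v : ι → α => scoreRank S v i := by
  unfold scoreRank
  simp_rw [Finset.card_filter]
  refine Finset.measurable_sum _ fun j _ => Measurable.ite (measurableSet_le ?_ ?_)
    measurable_const measurable_const
  · exact hS.comp (measurable_pi_apply j)
  · exact hS.comp (measurable_pi_apply i)

variable (Q : Measure α) [IsProbabilityMeasure Q]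

/-- Exchangeability: swapping the two coordinates preserves the product measure and carries one rank
to the other. -/
lemma pi_scoreRank_eq (i i' : ι) (A : Set ℕ) :
    Measure.pi (fun _ : ι => Q) {v | scoreRank S v i ∈ A} =
      Measure.pi (fun _ : ι => Q) {v | scoreRank S v i' ∈ A} := by
  classical
  have h := measurePreserving_arrowCongr' (fun _ => Q) (fun _ => Q) (Equiv.swap i i')
    (MeasurableEquiv.refl α) (fun _ => MeasurePreserving.id Q)
  rw [← h.measure_preimage_equiv]
  congr 1
  ext v
  have key : scoreRank S (MeasurableEquiv.arrowCongr' (Equiv.swap i i') (MeasurableEquiv.refl α) v)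
      i = scoreRank S v i' := by
    refine Finset.card_bij (fun j _ => Equiv.swap i i' j) ?_ ?_ ?_
    · intro j hj
      simpa [MeasurableEquiv.arrowCongr', Equiv.arrowCongr'] using hj
    · intro j _ k _ hjk
      exact (Equiv.swap i i').injective hjk
    · intro j hj
      refine ⟨Equiv.swap i i' j, ?_, by simp⟩
      simpa [MeasurableEquiv.arrowCongr', Equiv.arrowCongr'] using hj
  simp [key]

/-- Two distinct coordinates have joint law `Q.prod Q`, so by Fubini a tie between atomless scores
is a null event; there are finitely many pairs. -/
lemma ae_injective_score (hS : Measurable S) (hatom : ∀ t, Q {w | S w = t} = 0) :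
    ∀ᵐ v ∂Measure.pi (fun _ : ι => Q), Function.Injective fun i => S (v i) := by
  have hpair : ∀ i j : ι, i ≠ j → ∀ᵐ v ∂Measure.pi (fun _ : ι => Q), S (v i) ≠ S (v j) := by
    intro i j hij
    have hind : IndepFun (fun v : ι → α => v i) (fun v => v j) (Measure.pi fun _ : ι => Q) :=
      (iIndepFun_pi (X := fun _ => id) (fun _ => aemeasurable_id)).indepFun hij
    have hmap := (indepFun_iff_map_prod_eq_prod_map_map (measurable_pi_apply i).aemeasurable
      (measurable_pi_apply j).aemeasurable).1 hind
    have hev : ∀ k : ι, (Measure.pi fun _ : ι => Q).map (fun v => v k) = Q :=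
      fun k => (measurePreserving_eval (fun _ : ι => Q) k).map_eq
    rw [hev, hev] at hmap
    have hmeas : MeasurableSet {q : α × α | S q.1 ≠ S q.2} :=
      (measurableSet_eq_fun (hS.comp measurable_fst) (hS.comp measurable_snd)).compl
    have hprod : ∀ᵐ q ∂Q.prod Q, S q.1 ≠ S q.2 := by
      rw [Measure.ae_prod_iff_ae_ae hmeas]
      refine Filter.Eventually.of_forall fun a => ?_
      have := hatom (S a)
      rw [ae_iff]
      simpa [eq_comm] using this
    rw [← hmap] at hprod
    exact ae_of_ae_map (f := fun v : ι → α => (v i, v j)) (by fun_prop) hprod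
  have hall : ∀ᵐ v ∂Measure.pi (fun _ : ι => Q), ∀ i j : ι, i ≠ j → S (v i) ≠ S (v j) := by
    rw [ae_all_iff]; intro i
    rw [ae_all_iff]; intro j
    by_cases hij : i = j
    · simp [hij]
    · filter_upwards [hpair i j hij] with v hv _ using hv
  filter_upwards [hall] with v hv i j hij
  by_contra h
  exact hv i j h hij

/-- The rank of a coordinate among i.i.d. draws with atomless scores is uniformly distributed. -/
lemma pi_scoreRank (hS : Measurable S) (hatom : ∀ t, Q {w | S w = t} = 0) (i : ι) {A : Finset ℕ}
    (hA : A ⊆ Finset.Icc 1 (Fintype.card ι)) :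
    Fintype.card ι * Measure.pi (fun _ : ι => Q) {v | scoreRank S v i ∈ A} = A.card := by
  have hm : ∀ j, MeasurableSet {v : ι → α | scoreRank S v j ∈ A} := fun j =>
    measurable_scoreRank hS j (MeasurableSet.of_discrete (s := (A : Set ℕ)))
  -- All coordinates have the same probability of a rank in `A`, and almost surely exactly `A.card`
  -- of them have one; integrate that count.
  calc Fintype.card ι * Measure.pi (fun _ : ι => Q) {v | scoreRank S v i ∈ A}
      = ∑ j, Measure.pi (fun _ : ι => Q) {v | scoreRank S v j ∈ A} := by
        refine Eq.trans ?_ (Finset.sum_congr rfl fun j _ => pi_scoreRank_eq Q i j (A : Set ℕ))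
        simp
    _ = ∑ j, ∫⁻ v, {v : ι → α | scoreRank S v j ∈ A}.indicator 1 v
          ∂Measure.pi (fun _ : ι => Q) := by
        refine Finset.sum_congr rfl fun j _ => ?_
        rw [lintegral_indicator_one (hm j)]
    _ = ∫⁻ v, ∑ j, {v : ι → α | scoreRank S v j ∈ A}.indicator 1 v
          ∂Measure.pi (fun _ : ι => Q) := by
        rw [lintegral_finsetSum _ fun j _ => measurable_one.indicator (hm j)]
    _ = ∫⁻ _, (A.card : ENNReal) ∂Measure.pi (fun _ : ι => Q) := by
        refine lintegral_congr_ae ?_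
        filter_upwards [ae_injective_score Q hS hatom] with v hv
        rw [← card_scoreRank_mem S v hv hA, Finset.card_filter]
        push_cast
        refine Finset.sum_congr rfl fun j _ => ?_
        simp [Set.indicator_apply]
    _ = A.card := by simp

end Exchangeable

/-- Coordinate `0` is the sample and the others its counterfeits; the `1 +` in `rank` is the sample
counting itself. -/
lemma rank_eq_scoreRank {𝒳 : Type*} {M : ℕ} (T : 𝒳 × unitInterval → ℝ) (x : 𝒳)
    (v : Fin (M + 1) → unitInterval) :
    rank T x (v 0) (fun i => v i.succ) = scoreRank (fun w => T (x, w)) v 0 := by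
  unfold rank scoreRank
  rw [Fin.card_filter_univ_succ]
  simp [add_comm]

/-- With atomless scores, a sample whose value is drawn like its counterfeits receives each of the
`L` labels with probability `1 / L`. -/
lemma lintegral_hasLabel_unif {𝒳 : Type*} [MeasurableSpace 𝒳] {M K L : ℕ} (hKL : M + 1 = K * L)
    {T : 𝒳 × unitInterval → ℝ} (hT : Measurable T) (x : 𝒳)
    (Q : Measure unitInterval) [IsProbabilityMeasure Q]
    (hatom : ∀ t, Q {w | T (x, w) = t} = 0) (ℓ : Fin L) :
    ∫⁻ w, Measure.pi (fun _ : Fin M => Q) {wt | HasLabel T K ℓ x w wt} ∂Q = (L : ENNReal)⁻¹ := by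
  have hS : Measurable fun w => T (x, w) := hT.comp (by fun_prop)
  set A := Finset.Icc (ℓ * K + 1) (K * (ℓ + 1)) with hA
  have hAsub : A ⊆ Finset.Icc 1 (Fintype.card (Fin (M + 1))) := by
    have : K * (ℓ + 1) ≤ K * L := Nat.mul_le_mul_left _ ℓ.2
    refine Finset.Icc_subset_Icc (by omega) (by simpa [hKL] using this)
  have hAcard : A.card = K := by
    rw [hA, Nat.card_Icc, mul_add, mul_comm K]; omega
  have hunif := pi_scoreRank Q hS hatom (0 : Fin (M + 1)) hAsub
  have hmp := measurePreserving_piFinSuccAbove (fun _ : Fin (M + 1) => Q) 0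
  have hset : MeasurableSet {q : unitInterval × (Fin M → unitInterval) |
      HasLabel T K ℓ x q.1 q.2} := by
    have : Measurable fun q : unitInterval × (Fin M → unitInterval) => rank T x q.1 q.2 :=
      (measurable_rank hT).comp (f := fun q : unitInterval × (Fin M → unitInterval) =>
        ((x, q.1), q.2)) (by fun_prop)
    exact this (MeasurableSet.of_discrete (s := {r | ℓ * K + 1 ≤ r ∧ r ≤ K * (ℓ + 1)}))
  have hint : ∫⁻ w, Measure.pi (fun _ : Fin M => Q) {wt | HasLabel T K ℓ x w wt} ∂Q =
      Measure.pi (fun _ : Fin (M + 1) => Q)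
        {v | scoreRank (fun w => T (x, w)) v 0 ∈ A} := by
    have := Measure.prod_apply (μ := Q) (ν := Measure.pi fun _ : Fin M => Q) hset
    rw [← hmp.measure_preimage_equiv] at this
    refine this.symm.trans ?_
    congr 1
    ext v
    rw [Set.mem_preimage, Set.mem_ofPred_eq, Set.mem_ofPred_eq, ← rank_eq_scoreRank, hA,
      Finset.mem_Icc]
    rfl
  rw [hint]
  have hcast : ((M + 1 : ℕ) : ENNReal) = K * L := by rw [hKL]; push_cast; rfl
  rw [hAcard, Fintype.card_fin, hcast] at hunif
  have hK : K ≠ 0 := by rintro rfl; simp at hKL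
  have hL : L ≠ 0 := by rintro rfl; simp at hKL
  rw [mul_assoc] at hunif
  -- The exchangeable count reads `K * L * probability = K`; `K` cancels as it is nonzero and
  -- finite.
  have h1 : (L : ENNReal) * Measure.pi (fun _ : Fin (M + 1) => Q)
      {v | scoreRank (fun w => T (x, w)) v 0 ∈ A} = 1 := by
    rw [← ENNReal.mul_right_inj (a := (K : ENNReal)) (by simpa using hK)
      (ENNReal.natCast_ne_top K), hunif, mul_one]
  exact ENNReal.eq_inv_of_mul_eq_one_left (by rwa [mul_comm])

/-! ### Extended-real integrals -/

section EIntegral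

variable {α : Type*} [MeasurableSpace α] {μ : Measure α}

lemma eintegral_congr_ae {g g' : α → EReal} (h : g =ᵐ[μ] g') : eintegral μ g = eintegral μ g' := by
  unfold eintegral
  rw [lintegral_congr_ae (h.mono fun x hx => by rw [hx]),
    lintegral_congr_ae (h.mono fun x (hx : g x = g' x) =>
      show (-g x).toENNReal = (-g' x).toENNReal by rw [hx])]

/-- No measurability is required, so the divergences need not be shown measurable in `x`. -/
lemma eintegral_mono_ae {g g' : α → EReal} (h : g ≤ᵐ[μ] g') : eintegral μ g ≤ eintegral μ g' := by
  unfold eintegral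
  refine EReal.sub_le_sub ?_ ?_
  · exact EReal.coe_ennreal_le_coe_ennreal_iff.2
      (lintegral_mono_ae (h.mono fun x hx => EReal.toENNReal_le_toENNReal hx))
  · exact EReal.coe_ennreal_le_coe_ennreal_iff.2
      (lintegral_mono_ae (h.mono fun x hx =>
        EReal.toENNReal_le_toENNReal (EReal.neg_le_neg_iff.2 hx)))

lemma coe_ennreal_eq_coe_toReal {x : ENNReal} (hx : x ≠ ⊤) :
    (x : EReal) = ((x.toReal : ℝ) : EReal) := by
  lift x to NNReal using hx
  rfl

lemma eintegral_coe_of_integrable {u : α → ℝ} (hu : Integrable u μ) :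
    eintegral μ (fun x => ((u x : ℝ) : EReal)) = ((∫ x, u x ∂μ : ℝ) : EReal) := by
  have h1 : ∫⁻ x, ENNReal.ofReal (u x) ∂μ ≠ ⊤ := hu.lintegral_lt_top.ne
  have h2 : ∫⁻ x, ENNReal.ofReal (-u x) ∂μ ≠ ⊤ := hu.neg.lintegral_lt_top.ne
  rw [integral_eq_lintegral_pos_part_sub_lintegral_neg_part hu, EReal.coe_sub,
    ← coe_ennreal_eq_coe_toReal h1, ← coe_ennreal_eq_coe_toReal h2]
  rfl

/-- An integrable `B` cannot offset an infinite integral of `A ≥ 0`: the negative part of the sum is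
dominated by that of `B`, so the form `∞ - ∞` never occurs. -/
lemma eintegral_add_coe {A B : α → ℝ} (hA : ∀ x, 0 ≤ A x) (hAm : Measurable A)
    (hB : Integrable B μ) :
    eintegral μ (fun x => ((A x + B x : ℝ) : EReal)) =
      ((∫⁻ x, ENNReal.ofReal (A x) ∂μ : ENNReal) : EReal) + ((∫ x, B x ∂μ : ℝ) : EReal) := by
  by_cases hfin : ∫⁻ x, ENNReal.ofReal (A x) ∂μ = ⊤
  · have hneg : ∫⁻ x, ENNReal.ofReal (-(A x + B x)) ∂μ ≠ ⊤ := by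
      refine ne_top_of_le_ne_top hB.neg.lintegral_lt_top.ne (lintegral_mono fun x => ?_)
      refine ENNReal.ofReal_le_ofReal ?_
      have := hA x
      simp only [Pi.neg_apply]
      linarith
    have hpos : ∫⁻ x, ENNReal.ofReal (A x + B x) ∂μ = ⊤ := by
      by_contra hne
      have hle : ∫⁻ x, ENNReal.ofReal (A x) ∂μ ≤
          ∫⁻ x, ENNReal.ofReal (-B x) ∂μ + ∫⁻ x, ENNReal.ofReal (A x + B x) ∂μ := by
        rw [← lintegral_add_left' (f := fun x => ENNReal.ofReal (-B x))
          hB.neg.aestronglyMeasurable.aemeasurable.ennreal_ofReal]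
        refine lintegral_mono fun x => ?_
        refine le_trans (ENNReal.ofReal_le_ofReal ?_) ENNReal.ofReal_add_le
        simp
      rw [hfin, top_le_iff, ENNReal.add_eq_top] at hle
      rcases hle with h | h
      · exact hB.neg.lintegral_lt_top.ne h
      · exact hne h
    have h1 : eintegral μ (fun x => ((A x + B x : ℝ) : EReal)) =
        ((∫⁻ x, ENNReal.ofReal (A x + B x) ∂μ : ENNReal) : EReal) -
        ((∫⁻ x, ENNReal.ofReal (-(A x + B x)) ∂μ : ENNReal) : EReal) := rfl
    rw [h1, hfin, hpos, coe_ennreal_eq_coe_toReal hneg, EReal.coe_ennreal_top,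
      EReal.top_sub_coe, EReal.top_add_coe]
  · have hAi : Integrable A μ := by
      refine ⟨hAm.aestronglyMeasurable, ?_⟩
      rw [hasFiniteIntegral_iff_ofReal (Filter.Eventually.of_forall hA)]
      exact lt_top_iff_ne_top.2 hfin
    have hAB : Integrable (fun x => A x + B x) μ := hAi.add hB
    rw [eintegral_coe_of_integrable hAB, integral_add hAi hB, EReal.coe_add,
      coe_ennreal_eq_coe_toReal hfin, integral_eq_lintegral_of_nonneg_ae
        (Filter.Eventually.of_forall hA) hAm.aestronglyMeasurable]

end EIntegral

/-! ### Convex functions up to affine terms -/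

/-- A continuous convex function on a closed half-line has an affine minorant. Freezing the
difference at its value at `0` for negative arguments makes it continuous on all of `ℝ`, hence
measurable. -/
lemma exists_nonneg_add_affine {f : ℝ → ℝ} (hfconv : ConvexOn ℝ (Set.Ici 0) f)
    (hfcont : ContinuousOn f (Set.Ici 0)) :
    ∃ (h : ℝ → ℝ) (c c' : ℝ), Continuous h ∧ (∀ t, 0 ≤ h t) ∧ ConvexOn ℝ (Set.Ici 0) h ∧
      ∀ t, 0 ≤ t → f t = h t + (c * t + c') := by
  obtain ⟨c, c', hc⟩ := hfconv.exists_affine_le_real isClosed_Ici hfcont.lowerSemicontinuousOn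
  have hmax : ∀ t : ℝ, max t 0 ∈ Set.Ici (0 : ℝ) := fun t => le_max_right t 0
  refine ⟨fun t => f (max t 0) - (c * max t 0 + c'), c, c', ?_, ?_, ?_, ?_⟩
  · exact (hfcont.comp_continuous (by fun_prop) hmax).sub (by fun_prop)
  · exact fun t => sub_nonneg.2 (hc _ (hmax t))
  · refine ConvexOn.congr (f := fun t => f t + (-c * t + -c')) ?_ ?_
    · refine hfconv.add ⟨convex_Ici 0, ?_⟩
      intro x _ y _ a b _ _ hab
      have : c' = a * c' + b * c' := by rw [← add_mul, hab, one_mul]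
      simp only [smul_eq_mul]
      linarith
    · intro t ht
      simp only [max_eq_left (Set.mem_Ici.1 ht)]
      ring
  · intro t ht
    simp only [max_eq_left ht]
    ring

/-! ### Divergences as nonnegative integrals, and data processing -/

section Divergence

/-- The integral `∫ h(dP/dQ) dQ` for nonnegative `h`. -/
noncomputable def divEnergy {α : Type*} [MeasurableSpace α] (h : ℝ → ℝ) (P Q : Measure α) : ENNReal :=
  ∫⁻ x, ENNReal.ofReal (h (P.rnDeriv Q x).toReal) ∂Q

/-- By the chain rule the density of `P` is `dP/dQ` times that of `Q`, so the integrand becomes `q *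
h (dP/dQ)` plus `c * p + c' * q`, whose integral is `c + c'`. -/
lemma fDiv_eq_divEnergy_add {α : Type*} [MeasureSpace α] [SigmaFinite (volume : Measure α)]
    {f h : ℝ → ℝ} {c c' : ℝ} (hcont : Continuous h) (hnn : ∀ t, 0 ≤ h t)
    (hf : ∀ t, 0 ≤ t → f t = h t + (c * t + c')) (P Q : Measure α) [IsProbabilityMeasure P]
    [IsProbabilityMeasure Q] (hPQ : P ≪ Q) (hQ : Q ≪ volume) :
    fDiv f P Q = (divEnergy h P Q : EReal) + ((c + c' : ℝ) : EReal) := by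
  have hprod := Measure.rnDeriv_mul_rnDeriv (κ := (volume : Measure α)) hPQ
  have hae : (fun t => ((density Q t * f (density P t / density Q t) : ℝ) : EReal)) =ᵐ[volume]
      fun t => ((density Q t * h (P.rnDeriv Q t).toReal +
        (c * density P t + c' * density Q t) : ℝ) : EReal) := by
    filter_upwards [hprod] with t ht
    have hp : density P t = (P.rnDeriv Q t).toReal * density Q t := by
      rw [density, ← ht, Pi.mul_apply, ENNReal.toReal_mul, density]
    congr 1
    -- Where `q` vanishes so does `p`, and both sides are `0`.
    by_cases hq : density Q t = 0
    · simp [hp, hq]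
    · rw [hp, mul_div_cancel_right₀ _ hq, hf _ ENNReal.toReal_nonneg]
      ring
  have hint : ∀ R : Measure α, IsProbabilityMeasure R → Integrable (density R) volume :=
    fun R _ => Measure.integrable_toReal_rnDeriv
  have hone : ∀ R : Measure α, IsProbabilityMeasure R → R ≪ volume →
      ∫ t, density R t = 1 := by
    intro R _ hR
    have := Measure.integral_toReal_rnDeriv hR
    rwa [probReal_univ] at this
  have hqm : Measurable (density Q) := (Measure.measurable_rnDeriv _ _).ennreal_toReal
  have hgm : Measurable fun t => h (P.rnDeriv Q t).toReal :=
    hcont.measurable.comp (Measure.measurable_rnDeriv _ _).ennreal_toReal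
  have hBi : Integrable (fun t => c * density P t + c' * density Q t) volume :=
    ((hint P inferInstance).const_mul c).add ((hint Q inferInstance).const_mul c')
  rw [fDiv, fDivDensity, eintegral_congr_ae hae,
    eintegral_add_coe (A := fun t => density Q t * h (P.rnDeriv Q t).toReal)
      (fun t => mul_nonneg ENNReal.toReal_nonneg (hnn _)) (hqm.mul hgm) hBi,
    integral_add ((hint P inferInstance).const_mul c) ((hint Q inferInstance).const_mul c'),
    integral_const_mul, integral_const_mul, hone P inferInstance (hPQ.trans hQ),
    hone Q inferInstance hQ, mul_one, mul_one]
  congr 2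
  rw [divEnergy, ← lintegral_rnDeriv_mul hQ hgm.ennreal_ofReal.aemeasurable]
  refine lintegral_congr_ae ?_
  filter_upwards [Measure.rnDeriv_lt_top Q volume] with t ht
  rw [density, ENNReal.ofReal_mul ENNReal.toReal_nonneg, ENNReal.ofReal_toReal ht.ne]

variable {h : ℝ → ℝ}

lemma ofReal_map_integral_le (hcont : Continuous h) (hnn : ∀ t, 0 ≤ h t)
    (hconv : ConvexOn ℝ (Set.Ici 0) h)
    {α : Type*} [MeasurableSpace α] (ν : Measure α)
    [IsProbabilityMeasure ν] {g : α → ℝ} (hg : ∀ x, 0 ≤ g x) (hgi : Integrable g ν) :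
    ENNReal.ofReal (h (∫ x, g x ∂ν)) ≤ ∫⁻ x, ENNReal.ofReal (h (g x)) ∂ν := by
  by_cases hfin : ∫⁻ x, ENNReal.ofReal (h (g x)) ∂ν = ⊤
  · simp [hfin]
  have hm : AEStronglyMeasurable (fun x => h (g x)) ν := hcont.comp_aestronglyMeasurable hgi.1
  have hhi : Integrable (fun x => h (g x)) ν := by
    refine ⟨hm, ?_⟩
    rw [hasFiniteIntegral_iff_ofReal (Filter.Eventually.of_forall fun x => hnn _)]
    exact lt_top_iff_ne_top.2 hfin
  rw [← ofReal_integral_eq_lintegral_ofReal hhi (Filter.Eventually.of_forall fun x => hnn _)]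
  exact ENNReal.ofReal_le_ofReal (hconv.map_integral_le hcont.continuousOn isClosed_Ici
    (Filter.Eventually.of_forall hg) hgi hhi)

/-- Data processing under a measurable map. -/
lemma divEnergy_map_le (hcont : Continuous h) (hnn : ∀ t, 0 ≤ h t)
    (hconv : ConvexOn ℝ (Set.Ici 0) h)
    {α β : Type*} [MeasurableSpace α] [StandardBorelSpace α] [Nonempty α]
    [MeasurableSpace β] (P Q : Measure α) [IsProbabilityMeasure P] [IsProbabilityMeasure Q]
    (hPQ : P ≪ Q) {S : α → β} (hS : Measurable S) :
    divEnergy h (P.map S) (Q.map S) ≤ divEnergy h P Q := by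
  -- `κ t` is the law under `Q` of a point conditioned on `S = t`.
  set κ := condDistrib id S Q with hκdef
  have hκ : (Q.map S) ⊗ₘ κ = Q.map (fun a => (S a, a)) :=
    compProd_map_condDistrib (X := S) aemeasurable_id
  have := Measure.isProbabilityMeasure_map (μ := Q) hS.aemeasurable
  have := Measure.isProbabilityMeasure_map (μ := P) hS.aemeasurable
  set p : α → ℝ := fun a => (P.rnDeriv Q a).toReal with hp
  have hpm : Measurable p := (Measure.measurable_rnDeriv _ _).ennreal_toReal
  have hdis : ∀ F : β × α → ENNReal, Measurable F →
      ∫⁻ t, ∫⁻ a, F (t, a) ∂κ t ∂(Q.map S) = ∫⁻ a, F (S a, a) ∂Q := by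
    intro F hF
    rw [← Measure.lintegral_compProd hF, hκ, lintegral_map hF (by fun_prop)]
  -- The density of the image law is the conditional expectation of `dP/dQ` given `S`; Jensen under
  -- `κ t` then concludes.
  set G : β → ENNReal := fun t => ∫⁻ a, ENNReal.ofReal (p a) ∂κ t with hG
  have hGm : Measurable G := hpm.ennreal_ofReal.lintegral_kernel
  have hdens : P.map S = (Q.map S).withDensity G := by
    ext B hB
    rw [withDensity_apply _ hB, Measure.map_apply hS hB, ← lintegral_indicator hB]
    have h1 : ∀ t, B.indicator G t =
        ∫⁻ a, B.indicator 1 t * ENNReal.ofReal (p a) ∂κ t := by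
      intro t
      rw [lintegral_const_mul _ hpm.ennreal_ofReal]
      by_cases ht : t ∈ B <;> simp [ht, hG]
    simp_rw [h1]
    rw [hdis (fun z => B.indicator 1 z.1 * ENNReal.ofReal (p z.2))
      (((measurable_one.indicator hB).comp measurable_fst).mul
        (hpm.comp measurable_snd).ennreal_ofReal)]
    rw [← lintegral_indicator_one (hS hB), ← lintegral_rnDeriv_mul hPQ
      ((measurable_one.indicator (hS hB)).aemeasurable)]
    refine lintegral_congr_ae ?_
    filter_upwards [Measure.rnDeriv_lt_top P Q] with a ha
    simp only [hp, ENNReal.ofReal_toReal ha.ne]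
    rw [mul_comm]
    rfl
  have hrn : (P.map S).rnDeriv (Q.map S) =ᵐ[Q.map S] G := by
    rw [hdens]
    exact Measure.rnDeriv_withDensity _ hGm
  have hfin : ∀ᵐ t ∂(Q.map S), G t < ⊤ := by
    refine ae_lt_top hGm ?_
    have : ∫⁻ t, G t ∂(Q.map S) = P.map S Set.univ := by
      rw [hdens, withDensity_apply _ MeasurableSet.univ, Measure.restrict_univ]
    rw [this]
    exact measure_ne_top _ _
  calc divEnergy h (P.map S) (Q.map S)
      ≤ ∫⁻ t, ∫⁻ a, ENNReal.ofReal (h (p a)) ∂κ t ∂(Q.map S) := by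
        refine lintegral_mono_ae ?_
        filter_upwards [hrn, hfin] with t ht htf
        have hpi : Integrable p (κ t) := by
          refine ⟨hpm.aestronglyMeasurable, ?_⟩
          rw [hasFiniteIntegral_iff_ofReal (Filter.Eventually.of_forall fun _ =>
            ENNReal.toReal_nonneg)]
          exact htf
        have heq : (G t).toReal = ∫ a, p a ∂κ t :=
          (integral_eq_lintegral_of_nonneg_ae (Filter.Eventually.of_forall fun _ =>
            ENNReal.toReal_nonneg) hpm.aestronglyMeasurable).symm
        rw [ht, heq]
        exact ofReal_map_integral_le hcont hnn hconv (κ t) (fun _ => ENNReal.toReal_nonneg) hpi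
    _ = divEnergy h P Q :=
        hdis (fun z => ENNReal.ofReal (h (p z.2)))
          ((hcont.measurable.comp (hpm.comp measurable_snd)).ennreal_ofReal)

/-- Data processing under a randomized finite-valued map that is uniform under `Q`. -/
lemma sum_ofReal_le_divEnergy (hcont : Continuous h) (hnn : ∀ t, 0 ≤ h t)
    (hconv : ConvexOn ℝ (Set.Ici 0) h)
    {β : Type*} [MeasurableSpace β] (P Q : Measure β)
    [IsProbabilityMeasure P] [IsProbabilityMeasure Q] (hPQ : P ≪ Q) {L : ℕ} (hL : L ≠ 0)
    {k : Fin L → β → ENNReal} (hk : ∀ ℓ, Measurable (k ℓ)) (hsum : ∀ t, ∑ ℓ, k ℓ t = 1)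
    (hunif : ∀ ℓ, ∫⁻ t, k ℓ t ∂Q = (L : ENNReal)⁻¹) :
    ∑ ℓ, ENNReal.ofReal (h (L * (∫⁻ t, k ℓ t ∂P).toReal)) ≤ L * divEnergy h P Q := by
  have hL0 : (L : ENNReal) ≠ 0 := by simpa using hL
  have hLt : (L : ENNReal) ≠ ⊤ := ENNReal.natCast_ne_top L
  set g : β → ℝ := fun t => (P.rnDeriv Q t).toReal with hg
  have hgm : Measurable g := (Measure.measurable_rnDeriv _ _).ennreal_toReal
  have hhg : Measurable fun t => ENNReal.ofReal (h (g t)) :=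
    (hcont.measurable.comp hgm).ennreal_ofReal
  have hterm : ∀ ℓ, ENNReal.ofReal (h (L * (∫⁻ t, k ℓ t ∂P).toReal)) ≤
      ∫⁻ t, L * k ℓ t * ENNReal.ofReal (h (g t)) ∂Q := by
    intro ℓ
    have hkm : Measurable fun t => L * k ℓ t := (hk ℓ).const_mul _
    -- This is `Q` conditioned on the label `ℓ`: the label has probability `1 / L` under `Q`, hence
    -- the factor `L`. Under `m` the mean of `dP/dQ` is `L` times the probability of `ℓ` under `P`,
    -- so Jensen gives the term for `ℓ`. Summing over `ℓ` recovers `Q`, up to the factor `L`.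
    set m := Q.withDensity (fun t => L * k ℓ t) with hm
    have hprob : IsProbabilityMeasure m := by
      refine ⟨?_⟩
      rw [hm, withDensity_apply _ MeasurableSet.univ, Measure.restrict_univ,
        lintegral_const_mul _ (hk ℓ), hunif, ENNReal.mul_inv_cancel hL0 hLt]
    have hlin : ∀ F : β → ENNReal, Measurable F →
        ∫⁻ t, F t ∂m = ∫⁻ t, L * k ℓ t * F t ∂Q := by
      intro F hF
      rw [hm, lintegral_withDensity_eq_lintegral_mul _ hkm hF]
      rfl
    have hkP : ∫⁻ t, k ℓ t ∂P ≠ ⊤ := by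
      refine ne_top_of_le_ne_top ENNReal.one_ne_top ?_
      calc ∫⁻ t, k ℓ t ∂P ≤ ∫⁻ _, 1 ∂P := lintegral_mono fun t => by
            rw [← hsum t]
            exact Finset.single_le_sum (f := fun ℓ => k ℓ t) (fun _ _ => zero_le) (Finset.mem_univ ℓ)
        _ = 1 := by simp
    have hgint : ∫⁻ t, ENNReal.ofReal (g t) ∂m = L * ∫⁻ t, k ℓ t ∂P := by
      rw [hlin _ hgm.ennreal_ofReal, ← lintegral_rnDeriv_mul hPQ (hk ℓ).aemeasurable,
        ← lintegral_const_mul (f := fun t => P.rnDeriv Q t * k ℓ t) _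
          ((Measure.measurable_rnDeriv _ _).mul (hk ℓ))]
      refine lintegral_congr_ae ?_
      filter_upwards [Measure.rnDeriv_lt_top P Q] with t ht
      rw [hg, ENNReal.ofReal_toReal ht.ne]
      ring
    have hgi : Integrable g m := by
      refine ⟨hgm.aestronglyMeasurable, ?_⟩
      rw [hasFiniteIntegral_iff_ofReal (Filter.Eventually.of_forall fun _ =>
        ENNReal.toReal_nonneg), hgint]
      exact ENNReal.mul_lt_top hLt.lt_top hkP.lt_top
    have heq : ∫ t, g t ∂m = L * (∫⁻ t, k ℓ t ∂P).toReal := by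
      rw [integral_eq_lintegral_of_nonneg_ae (Filter.Eventually.of_forall fun _ =>
        ENNReal.toReal_nonneg) hgm.aestronglyMeasurable, hgint, ENNReal.toReal_mul,
        ENNReal.toReal_natCast]
    rw [← hlin _ hhg, ← heq]
    exact ofReal_map_integral_le hcont hnn hconv m (fun _ => ENNReal.toReal_nonneg) hgi
  calc ∑ ℓ, ENNReal.ofReal (h (L * (∫⁻ t, k ℓ t ∂P).toReal))
      ≤ ∑ ℓ, ∫⁻ t, L * k ℓ t * ENNReal.ofReal (h (g t)) ∂Q :=
        Finset.sum_le_sum fun ℓ _ => hterm ℓ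
    _ = ∫⁻ t, ∑ ℓ, L * k ℓ t * ENNReal.ofReal (h (g t)) ∂Q := by
        rw [lintegral_finsetSum (f := fun ℓ t => L * k ℓ t * ENNReal.ofReal (h (g t))) _
          fun ℓ _ => ((hk ℓ).const_mul _).mul hhg]
    _ = L * divEnergy h P Q := by
        rw [divEnergy, ← lintegral_const_mul _ hhg]
        refine lintegral_congr fun t => ?_
        rw [← Finset.sum_mul, ← Finset.mul_sum, hsum, mul_one]

end Divergence

/-! ### Conditional laws -/

/-- The kernel that keeps `x`, draws `y` and applies `T` disintegrates the law of `(X, T (X, Y))`;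
conditional laws are almost everywhere unique. -/
lemma condDistrib_comp_pair {Ω α β γ : Type*} [MeasurableSpace Ω] [MeasurableSpace α]
    [MeasurableSpace β] [StandardBorelSpace β] [Nonempty β] [MeasurableSpace γ]
    [StandardBorelSpace γ] [Nonempty γ] (μ : Measure Ω) [IsFiniteMeasure μ] {X : Ω → α}
    {Y : Ω → β} (hX : Measurable X) (hY : Measurable Y) {T : α × β → γ} (hT : Measurable T) :
    ∀ᵐ x ∂μ.map X, condDistrib (fun ω => T (X ω, Y ω)) X μ x =
      (condDistrib Y X μ x).map fun y => T (x, y) := by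
  have hx : ∀ x, Measurable fun y => T (x, y) := fun x => hT.comp (by fun_prop)
  let κ : Kernel α γ := (Kernel.id ×ₖ condDistrib Y X μ).map T
  have hκ : ∀ x, κ x = (condDistrib Y X μ x).map fun y => T (x, y) := by
    intro x
    rw [Kernel.map_apply _ hT, Kernel.prod_apply, Kernel.id_apply, Measure.dirac_prod,
      Measure.map_map hT (by fun_prop)]
    rfl
  have hm : Measurable fun q : α × β => (q.1, T q) := measurable_fst.prodMk hT
  have : IsMarkovKernel κ := Kernel.IsMarkovKernel.map _ hT
  have h := condDistrib_ae_eq_of_measure_eq_compProd_of_measurable (μ := μ) hX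
    (hT.comp (hX.prodMk hY)) (κ := κ) (by
      have h1 : μ.map (fun ω => (X ω, (T ∘ fun ω => (X ω, Y ω)) ω)) =
          (μ.map fun ω => (X ω, Y ω)).map fun q => (q.1, T q) := by
        rw [Measure.map_map hm (hX.prodMk hY)]
        rfl
      rw [h1, ← compProd_map_condDistrib hY.aemeasurable]
      ext s hs
      rw [Measure.map_apply hm hs, Measure.compProd_apply (hm hs), Measure.compProd_apply hs]
      refine lintegral_congr fun x => ?_
      rw [hκ, Measure.map_apply (hx x) (measurable_prodMk_left hs)]
      rfl)
  filter_upwards [h] with x hx'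
  rw [← hκ, ← hx']
  rfl

section Law

variable {𝒳 : Type*} [MeasurableSpace 𝒳] (P : Measure (𝒳 × Bool)) [IsProbabilityMeasure P]
  (ηhat : 𝒳 → unitInterval) (hη : Measurable ηhat)

instance : IsProbabilityMeasure (lawXYW P ηhat hη) := by
  unfold lawXYW
  infer_instance

lemma popLaw_map_X : (popLaw P ηhat hη).map (fun z => z.1.1.1) = P.fst := by
  have h1 : (fun z : ((𝒳 × Bool) × unitInterval) × unitInterval => z.1.1.1) =
      (fun z => z.1) ∘ (fun z => z.1) ∘ fun z => z.1 := rfl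
  rw [h1, ← Measure.map_map (by fun_prop) (by fun_prop),
    ← Measure.map_map (by fun_prop) (by fun_prop)]
  change (((popLaw P ηhat hη).fst).fst).fst = P.fst
  rw [popLaw, Measure.fst_prod, lawXYW, Measure.fst_compProd]

lemma popLaw_map_XW {𝒳 : Type*} [MeasurableSpace 𝒳] (P : Measure (𝒳 × Bool))
    (ηhat : 𝒳 → unitInterval) (hη : Measurable ηhat) :
    (popLaw P ηhat hη).map (fun z => (z.1.1.1, z.1.2)) =
    (lawXYW P ηhat hη).map fun z => (z.1.1, z.2) := by
  have h1 : (fun z : ((𝒳 × Bool) × unitInterval) × unitInterval => (z.1.1.1, z.1.2)) =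
      (fun z : (𝒳 × Bool) × unitInterval => (z.1.1, z.2)) ∘ fun z => z.1 := rfl
  rw [h1, ← Measure.map_map (by fun_prop) (by fun_prop)]
  congr 1
  change (popLaw P ηhat hη).fst = _
  rw [popLaw, Measure.fst_prod]

lemma lawXYW_map_XW_eq_compProd_condW : (lawXYW P ηhat hη).map (fun z => (z.1.1, z.2)) =
    P.fst ⊗ₘ condW P ηhat hη := by
  rw [← popLaw_map_XW, ← popLaw_map_X P ηhat hη, condW, compProd_map_condDistrib (by fun_prop)]

lemma condWt_ae_eq : ∀ᵐ x ∂P.fst, condWt P ηhat hη x = unif01 := by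
  have h := condDistrib_ae_eq_of_measure_eq_compProd_of_measurable (μ := popLaw P ηhat hη)
    (X := fun z => z.1.1.1) (Y := fun z => z.2) (by fun_prop) (by fun_prop)
    (κ := Kernel.const 𝒳 unif01) (by
      rw [Measure.compProd_const]
      have h1 : (fun z : ((𝒳 × Bool) × unitInterval) × unitInterval => (z.1.1.1, z.2)) =
        Prod.map (fun z => z.1.1) id := rfl
      have h2 : (lawXYW P ηhat hη).map (fun z => z.1.1) =
          (popLaw P ηhat hη).map (fun z => z.1.1.1) := by
        have h3 : (fun z : ((𝒳 × Bool) × unitInterval) × unitInterval => z.1.1.1) =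
          (fun z => z.1.1) ∘ fun z => z.1 := rfl
        rw [h3, ← Measure.map_map (by fun_prop) (by fun_prop)]
        congr 1
        change _ = (popLaw P ηhat hη).fst
        rw [popLaw, Measure.fst_prod]
      rw [h1, ← h2, popLaw, ← Measure.map_prod_map _ _ (by fun_prop) measurable_id, Measure.map_id])
  rw [popLaw_map_X] at h
  filter_upwards [h] with x hx
  rw [condWt, hx, Kernel.const_apply]

/-- Given `x`, draw `y` from its conditional law, then `w`, and forget `y`. -/
lemma condW_ae_eq : ∀ᵐ x ∂P.fst, condW P ηhat hη x =
    (P.condKernel ⊗ₖ wKernel ηhat hη).snd x := by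
  have h := condDistrib_ae_eq_of_measure_eq_compProd_of_measurable (μ := popLaw P ηhat hη)
    (X := fun z => z.1.1.1) (Y := fun z => z.1.2) (by fun_prop) (by fun_prop)
    (κ := (P.condKernel ⊗ₖ wKernel ηhat hη).snd) (by
      rw [popLaw_map_XW, popLaw_map_X, Kernel.snd_eq, Measure.compProd_map measurable_snd, lawXYW]
      conv_lhs => rw [← P.disintegrate P.condKernel]
      rw [← Measure.compProd_assoc, Measure.map_map (by fun_prop) (by fun_prop)]
      rfl)
  rw [popLaw_map_X] at h
  exact h

/-- A degenerate interval occurs only as `[0, 0]` or `[1, 1]`, so any singular mass sits at an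
endpoint. -/
lemma wKernel_apply_eq_zero (z : 𝒳 × Bool) {s : Set unitInterval} (hs : MeasurableSet s)
    (h0 : (volume : Measure unitInterval) s = 0) (hs0 : (0 : unitInterval) ∉ s)
    (hs1 : (1 : unitInterval) ∉ s) : wKernel ηhat hη z s = 0 := by
  have hac : ∀ a b : unitInterval, a < b → unifIcc a b s = 0 := by
    intro a b hab
    rw [unifIcc, if_pos hab]
    exact cond_absolutelyContinuous h0
  change (if z.2 = true then unifIcc 0 (ηhat z.1) else unifIcc (ηhat z.1) 1) s = 0
  split_ifs
  · by_cases h : 0 < ηhat z.1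
    · exact hac _ _ h
    · rw [unifIcc, if_neg h, Measure.dirac_apply' _ hs, Set.indicator_of_notMem hs0]
  · by_cases h : ηhat z.1 < 1
    · exact hac _ _ h
    · have h1 : ηhat z.1 = 1 := le_antisymm unitInterval.le_one' (not_lt.1 h)
      rw [unifIcc, if_neg h, Measure.dirac_apply' _ hs, h1, Set.indicator_of_notMem hs1]

/-- Off the endpoints of the unit interval the conditional law of `W` is absolutely continuous. -/
lemma condW_absolutelyContinuous : ∀ᵐ x ∂P.fst,
    (∀ w, condW P ηhat hη x {w} = 0) → condW P ηhat hη x ≪ unif01 := by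
  filter_upwards [condW_ae_eq P ηhat hη] with x hx hatom
  refine Measure.AbsolutelyContinuous.mk fun s hs h0 => ?_
  have hsub : s ⊆ (s \ {0, 1}) ∪ ({0} ∪ {1}) := by
    intro w hw
    by_cases h : w ∈ ({0, 1} : Set unitInterval)
    · exact Or.inr h
    · exact Or.inl ⟨hw, h⟩
  refine measure_mono_null hsub (measure_union_null ?_ (measure_union_null (hatom 0) (hatom 1)))
  have hs' : MeasurableSet (s \ {0, 1}) := hs.diff (by measurability)
  rw [hx, Kernel.snd_apply' _ _ hs', Kernel.compProd_apply (measurable_snd hs')]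
  refine lintegral_eq_zero_of_ae_eq_zero (Filter.Eventually.of_forall fun y => ?_)
  exact wKernel_apply_eq_zero ηhat hη (x, y) hs' (measure_mono_null Set.sdiff_subset h0)
    (by simp) (by simp)

variable {T : 𝒳 × unitInterval → ℝ}

lemma condTW_ae_eq (hT : Measurable T) : ∀ᵐ x ∂P.fst,
    condTW P ηhat hη T x = (condW P ηhat hη x).map fun w => T (x, w) := by
  have h := condDistrib_comp_pair (popLaw P ηhat hη) (X := fun z => z.1.1.1)
    (Y := fun z => z.1.2) (by fun_prop) (by fun_prop) hT
  rwa [popLaw_map_X] at h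

lemma condTWt_ae_eq (hT : Measurable T) : ∀ᵐ x ∂P.fst,
    condTWt P ηhat hη T x = unif01.map fun w => T (x, w) := by
  have h := condDistrib_comp_pair (popLaw P ηhat hη) (X := fun z => z.1.1.1)
    (Y := fun z => z.2) (by fun_prop) (by fun_prop) hT
  rw [popLaw_map_X] at h
  filter_upwards [h, condWt_ae_eq P ηhat hη] with x hx hx'
  rw [← hx', condTWt, hx, condWt]

instance : IsMarkovKernel (condW P ηhat hη) := by
  unfold condW
  infer_instance

/-- The conditional probability of the label `ℓ` given `X = x`. -/
noncomputable def condLabelProb (T : 𝒳 × unitInterval → ℝ) (M K ℓ : ℕ) (x : 𝒳) : ENNReal :=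
  ∫⁻ w, Measure.pi (fun _ : Fin M => unif01) {wt | HasLabel T K ℓ x w wt} ∂condW P ηhat hη x

lemma measurableSet_hasLabel {M : ℕ} (hT : Measurable T) (K ℓ : ℕ) :
    MeasurableSet {z : (𝒳 × unitInterval) × (Fin M → unitInterval) |
      HasLabel T K ℓ z.1.1 z.1.2 z.2} :=
  measurable_rank hT (MeasurableSet.of_discrete (s := {r | ℓ * K + 1 ≤ r ∧ r ≤ K * (ℓ + 1)}))

lemma measurable_condLabelProb (hT : Measurable T) (M K ℓ : ℕ) :
    Measurable (condLabelProb P ηhat hη T M K ℓ) :=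
  Measurable.lintegral_kernel_prod_right' (κ := condW P ηhat hη)
    (measurable_measure_prodMk_left (measurableSet_hasLabel hT K ℓ))

lemma condLabelProb_le_one (T : 𝒳 × unitInterval → ℝ) (M K ℓ : ℕ) (x : 𝒳) :
    condLabelProb P ηhat hη T M K ℓ x ≤ 1 := by
  calc condLabelProb P ηhat hη T M K ℓ x ≤ ∫⁻ _, 1 ∂condW P ηhat hη x :=
        lintegral_mono fun _ => prob_le_one
    _ = 1 := by simp

lemma labelProb_eq_integral (hT : Measurable T) (M K ℓ : ℕ) :
    labelProb P ηhat hη T M K ℓ = ∫ x, (condLabelProb P ηhat hη T M K ℓ x).toReal ∂P.fst := by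
  rw [integral_toReal (measurable_condLabelProb P ηhat hη hT M K ℓ).aemeasurable
    (Filter.Eventually.of_forall fun x =>
      (condLabelProb_le_one P ηhat hη T M K ℓ x).trans_lt ENNReal.one_lt_top)]
  rw [labelProb, Measure.real]
  congr 1
  have hset := measurableSet_hasLabel (M := M) hT K ℓ
  have hm := measurable_measure_prodMk_left (ν := Measure.pi fun _ : Fin M => unif01) hset
  have hset' : MeasurableSet {z : ((𝒳 × Bool) × unitInterval) × (Fin M → unitInterval) |
      HasLabel T K ℓ z.1.1.1 z.1.2 z.2} :=
    (show Measurable fun z : ((𝒳 × Bool) × unitInterval) × (Fin M → unitInterval) =>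
      ((z.1.1.1, z.1.2), z.2) by fun_prop) hset
  rw [sampleLaw, Measure.prod_apply hset']
  have key := Measure.lintegral_compProd (μ := P.fst) (κ := condW P ηhat hη) hm
  rw [← lawXYW_map_XW_eq_compProd_condW, lintegral_map hm (by fun_prop)] at key
  exact key

end Law

/-! ### The label as a randomized function of the score -/

section ScoreLabel

variable {α : Type*} [MeasurableSpace α] {S : α → ℝ} (Q : Measure α) [IsProbabilityMeasure Q]

/-- The probability that a score `t` is given the label `ℓ` when ranked among `M` independent
scores `S w̃` with `w̃` of law `Q`. -/
noncomputable def scoreLabelProb (S : α → ℝ) (M K ℓ : ℕ) (t : ℝ) : ENNReal :=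
  Measure.pi (fun _ : Fin M => Q) {wt | (Finset.univ.filter fun i => S (wt i) ≤ t).card / K = ℓ}

lemma measurable_card_score_le (hS : Measurable S) (M : ℕ) :
    Measurable fun z : ℝ × (Fin M → α) =>
      (Finset.univ.filter fun i => S (z.2 i) ≤ z.1).card := by
  simp_rw [Finset.card_filter]
  refine Finset.measurable_sum _ fun i _ => ?_
  exact Measurable.ite (measurableSet_le (hS.comp (by fun_prop)) measurable_fst)
    measurable_const measurable_const

lemma measurable_scoreLabelProb (hS : Measurable S) (M K ℓ : ℕ) :
    Measurable (scoreLabelProb Q S M K ℓ) :=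
  measurable_measure_prodMk_left
    (measurable_card_score_le hS M (MeasurableSet.of_discrete (s := {r | r / K = ℓ})))

lemma sum_scoreLabelProb (hS : Measurable S) {M K L : ℕ} (hKL : M + 1 = K * L) (t : ℝ) :
    ∑ ℓ : Fin L, scoreLabelProb Q S M K ℓ t = 1 := by
  let N : (Fin M → α) → Fin L := fun wt =>
    ⟨(Finset.univ.filter fun i => S (wt i) ≤ t).card / K, by
      refine Nat.div_lt_of_lt_mul ?_
      have h := Finset.card_filter_le (Finset.univ : Finset (Fin M)) (fun i => S (wt i) ≤ t)
      rw [Finset.card_univ, Fintype.card_fin] at h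
      omega⟩
  have hset : ∀ ℓ : Fin L, N ⁻¹' {ℓ} =
      {wt | (Finset.univ.filter fun i => S (wt i) ≤ t).card / K = ℓ} := by
    intro ℓ
    ext wt
    simp [N, Fin.ext_iff]
  have hN : Measurable N := by
    refine measurable_to_countable' fun ℓ => ?_
    rw [hset]
    exact ((measurable_card_score_le hS M).comp (measurable_prodMk_left (x := t)))
      (MeasurableSet.of_discrete (s := {r | r / K = ℓ}))
  have := Measure.isProbabilityMeasure_map (μ := Measure.pi fun _ : Fin M => Q) hN.aemeasurable
  have hterm : ∀ ℓ : Fin L, scoreLabelProb Q S M K ℓ t =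
      (Measure.pi fun _ : Fin M => Q).map N {ℓ} := by
    intro ℓ
    rw [Measure.map_apply hN (measurableSet_singleton ℓ), hset, scoreLabelProb]
  simp_rw [hterm]
  rw [MeasureTheory.sum_measure_singleton, Finset.coe_univ, measure_univ]

end ScoreLabel

/-- The label sees `w` only through its score, which is why the divergence between score laws
already bounds the label probabilities. The quotient has no `- 1` because the count omits the sample
itself. -/
lemma scoreLabelProb_eq_pi_hasLabel {𝒳 : Type*} {M K L : ℕ} (hKL : M + 1 = K * L)
    (T : 𝒳 × unitInterval → ℝ) (x : 𝒳) (w : unitInterval) (ℓ : Fin L) (Q : Measure unitInterval) :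
    scoreLabelProb Q (fun w => T (x, w)) M K ℓ (T (x, w)) =
      Measure.pi (fun _ : Fin M => Q) {wt | HasLabel T K ℓ x w wt} := by
  unfold scoreLabelProb
  congr 1
  ext wt
  rw [Set.mem_ofPred_eq, Set.mem_ofPred_eq, hasLabel_iff hKL, Fin.ext_iff, rankLabel]
  simp only [rank, Nat.add_sub_cancel_left]

/-! ### Assembling the chain of inequalities -/

section Main

variable {𝒳 : Type*} [MeasurableSpace 𝒳] (P : Measure (𝒳 × Bool)) [IsProbabilityMeasure P]
  (ηhat : 𝒳 → unitInterval) (hη : Measurable ηhat) {T : 𝒳 × unitInterval → ℝ}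

lemma sum_ofReal_condLabelProb_le (hT : Measurable T) {M K L : ℕ} (hKL : M + 1 = K * L) {h : ℝ → ℝ}
    (hcont : Continuous h) (hnn : ∀ t, 0 ≤ h t) (hconv : ConvexOn ℝ (Set.Ici 0) h) {x : 𝒳}
    (hc : unif01.map (fun w => T (x, w)) ≪ volume)
    (hac : (condW P ηhat hη x).map (fun w => T (x, w)) ≪ unif01.map fun w => T (x, w)) :
    ∑ ℓ : Fin L, ENNReal.ofReal (h (L * (condLabelProb P ηhat hη T M K ℓ x).toReal)) ≤
      L * divEnergy h ((condW P ηhat hη x).map fun w => T (x, w))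
        (unif01.map fun w => T (x, w)) := by
  have hS : Measurable fun w => T (x, w) := hT.comp (by fun_prop)
  have hL : L ≠ 0 := by rintro rfl; simp at hKL
  have := Measure.isProbabilityMeasure_map (μ := unif01) hS.aemeasurable
  have := Measure.isProbabilityMeasure_map (μ := condW P ηhat hη x) hS.aemeasurable
  -- A Lebesgue density of the counterfeit score rules out atoms, hence ties, which makes the labels
  -- uniform under `unif01`.
  have hatom : ∀ t, unif01 {w | T (x, w) = t} = 0 := by
    intro t
    have h1 := hc (Real.volume_singleton (a := t))
    rwa [Measure.map_apply hS (measurableSet_singleton t)] at h1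
  have hk : ∀ ℓ : Fin L, Measurable (scoreLabelProb unif01 (fun w => T (x, w)) M K ℓ) :=
    fun ℓ => measurable_scoreLabelProb unif01 hS M K ℓ
  have hmap : ∀ (ν : Measure unitInterval) (ℓ : Fin L),
      ∫⁻ t, scoreLabelProb unif01 (fun w => T (x, w)) M K ℓ t ∂ν.map (fun w => T (x, w)) =
        ∫⁻ w, Measure.pi (fun _ : Fin M => unif01) {wt | HasLabel T K ℓ x w wt} ∂ν := by
    intro ν ℓ
    rw [lintegral_map (hk ℓ) hS]
    simp_rw [scoreLabelProb_eq_pi_hasLabel hKL]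
  have key := sum_ofReal_le_divEnergy hcont hnn hconv
    ((condW P ηhat hη x).map fun w => T (x, w)) (unif01.map fun w => T (x, w)) hac hL hk
    (sum_scoreLabelProb unif01 hS hKL) fun ℓ => by
      rw [hmap, lintegral_hasLabel_unif hKL hT x unif01 hatom ℓ]
  simp_rw [hmap] at key
  exact key

lemma ofReal_inv_mul_sum {L : ℕ} {h : ℝ → ℝ} (hnn : ∀ t, 0 ≤ h t) (a : Fin L → ℝ) :
    ENNReal.ofReal (1 / (L : ℝ) * ∑ ℓ, h (a ℓ)) =
      (L : ENNReal)⁻¹ * ∑ ℓ, ENNReal.ofReal (h (a ℓ)) := by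
  rcases Nat.eq_zero_or_pos L with rfl | hL
  · simp
  rw [ENNReal.ofReal_mul (by positivity), ENNReal.ofReal_sum_of_nonneg fun ℓ _ => hnn _, one_div,
    ENNReal.ofReal_inv_of_pos (by positivity), ENNReal.ofReal_natCast]

/-- Jensen over `x`, one label at a time: `p ℓ` is the average of its conditional versions. -/
lemma ofReal_labelProb_le_lintegral (hT : Measurable T) (M K : ℕ) {L : ℕ} {h : ℝ → ℝ}
    (hcont : Continuous h) (hnn : ∀ t, 0 ≤ h t) (hconv : ConvexOn ℝ (Set.Ici 0) h) :
    ENNReal.ofReal (1 / (L : ℝ) * ∑ ℓ : Fin L, h (L * labelProb P ηhat hη T M K ℓ)) ≤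
      ∫⁻ x, ENNReal.ofReal (1 / (L : ℝ) *
        ∑ ℓ : Fin L, h (L * (condLabelProb P ηhat hη T M K ℓ x).toReal)) ∂P.fst := by
  have hm : ∀ ℓ : Fin L, Measurable fun x => (condLabelProb P ηhat hη T M K ℓ x).toReal :=
    fun ℓ => (measurable_condLabelProb P ηhat hη hT M K ℓ).ennreal_toReal
  have hhm : ∀ ℓ : Fin L, Measurable fun x =>
      ENNReal.ofReal (h (L * (condLabelProb P ηhat hη T M K ℓ x).toReal)) :=
    fun ℓ => (hcont.measurable.comp ((hm ℓ).const_mul _)).ennreal_ofReal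
  simp_rw [ofReal_inv_mul_sum hnn]
  rw [lintegral_const_mul _ (Finset.measurable_sum _ fun ℓ _ => hhm ℓ),
    lintegral_finsetSum _ fun ℓ _ => hhm ℓ]
  gcongr with ℓ
  rw [labelProb_eq_integral P ηhat hη hT, ← integral_const_mul]
  refine ofReal_map_integral_le hcont hnn hconv P.fst
    (fun x => mul_nonneg (Nat.cast_nonneg _) ENNReal.toReal_nonneg) (Integrable.const_mul ?_ _)
  refine Integrable.of_bound (hm ℓ).aestronglyMeasurable 1 (Filter.Eventually.of_forall fun x => ?_)
  rw [Real.norm_of_nonneg ENNReal.toReal_nonneg]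
  exact ENNReal.toReal_le_of_le_ofReal zero_le_one
    (by simpa using condLabelProb_le_one P ηhat hη T M K ℓ x)

/-- The conditional laws under the score assumption. -/
lemma ScoreAssumption.ae_absolutelyContinuous (hT : Measurable T)
    (hA : ScoreAssumption P ηhat hη T) : ∀ᵐ x ∂P.fst,
      condTW P ηhat hη T x = (condW P ηhat hη x).map (fun w => T (x, w)) ∧
      condTWt P ηhat hη T x = unif01.map (fun w => T (x, w)) ∧
      condWt P ηhat hη x = unif01 ∧ unif01.map (fun w => T (x, w)) ≪ volume ∧
      condW P ηhat hη x ≪ unif01 := by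
  filter_upwards [condTW_ae_eq P ηhat hη hT, condTWt_ae_eq P ηhat hη hT, condWt_ae_eq P ηhat hη,
    condW_absolutelyContinuous P ηhat hη, hA.density_o, hA.density_c] with x h1 h2 h3 h4 h5 h6
  refine ⟨h1, h2, h3, h2 ▸ h6, h4 fun w => ?_⟩
  have hS : Measurable fun w => T (x, w) := hT.comp (by fun_prop)
  -- An atom of `W` at `w` would give `T(X, W)` an atom at `T (x, w)`, contradicting its density.
  have h7 := h5 (Real.volume_singleton (a := T (x, w)))
  rw [h1, Measure.map_apply hS (measurableSet_singleton _)] at h7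
  exact measure_mono_null (by simp) h7

/-- As the `p ℓ` sum to one, the affine part averages to `c + c'`, the constant that also appears in
each divergence and so cancels. -/
lemma inv_mul_sum_affine {L : ℕ} (hL : L ≠ 0) {f h : ℝ → ℝ} {c c' : ℝ}
    (hf : ∀ t, 0 ≤ t → f t = h t + (c * t + c')) {p : Fin L → ℝ} (hp : ∀ ℓ, 0 ≤ p ℓ)
    (hsum : ∑ ℓ, p ℓ = 1) :
    1 / (L : ℝ) * ∑ ℓ, f (L * p ℓ) = 1 / (L : ℝ) * ∑ ℓ, h (L * p ℓ) + (c + c') := by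
  have hL' : (L : ℝ) ≠ 0 := by exact_mod_cast hL
  have h1 : ∀ ℓ, f (L * p ℓ) = h (L * p ℓ) + (c * L * p ℓ + c') := fun ℓ => by
    rw [hf _ (mul_nonneg (Nat.cast_nonneg _) (hp ℓ))]
    ring
  simp_rw [h1]
  rw [Finset.sum_add_distrib, Finset.sum_add_distrib, ← Finset.mul_sum, hsum]
  simp only [Finset.sum_const, Finset.card_univ, Fintype.card_fin, nsmul_eq_mul]
  field_simp

lemma le_eintegral_fDiv_score (hT : Measurable T) {M K L : ℕ} (hKL : M + 1 = K * L) {f : ℝ → ℝ}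
    (hfconv : ConvexOn ℝ (Set.Ici 0) f) (hfcont : ContinuousOn f (Set.Ici 0))
    (hA : ScoreAssumption P ηhat hη T) :
    ((1 / (L : ℝ) * ∑ ℓ : Fin L, f (L * labelProb P ηhat hη T M K ℓ) : ℝ) : EReal) ≤
      eintegral P.fst fun x => fDiv f (condTW P ηhat hη T x) (condTWt P ηhat hη T x) := by
  obtain ⟨h, c, c', hcont, hnn, hconv, hf⟩ := exists_nonneg_add_affine hfconv hfcont
  have hL : L ≠ 0 := by rintro rfl; simp at hKL
  set A : 𝒳 → ℝ := fun x => 1 / (L : ℝ) *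
    ∑ ℓ : Fin L, h (L * (condLabelProb P ηhat hη T M K ℓ x).toReal) with hAdef
  have hAnn : ∀ x, 0 ≤ A x := fun x =>
    mul_nonneg (by positivity) (Finset.sum_nonneg fun ℓ _ => hnn _)
  have hAm : Measurable A := by
    refine Measurable.const_mul (Finset.measurable_sum _ fun ℓ _ => ?_) _
    exact hcont.measurable.comp
      ((measurable_condLabelProb P ηhat hη hT M K ℓ).ennreal_toReal.const_mul _)
  calc ((1 / (L : ℝ) * ∑ ℓ : Fin L, f (L * labelProb P ηhat hη T M K ℓ) : ℝ) : EReal)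
      = ((ENNReal.ofReal (1 / (L : ℝ) * ∑ ℓ : Fin L, h (L * labelProb P ηhat hη T M K ℓ)) :
          ENNReal) : EReal) + ((c + c' : ℝ) : EReal) := by
        rw [inv_mul_sum_affine hL hf (p := fun ℓ : Fin L => labelProb P ηhat hη T M K ℓ)
          (fun _ => measureReal_nonneg) (sum_labelProb P ηhat hη hKL hT),
          EReal.coe_add, EReal.coe_ennreal_ofReal, max_eq_left
            (mul_nonneg (by positivity) (Finset.sum_nonneg fun ℓ _ => hnn _))]
    _ ≤ ((∫⁻ x, ENNReal.ofReal (A x) ∂P.fst : ENNReal) : EReal) + ((c + c' : ℝ) : EReal) := by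
        gcongr
        exact EReal.coe_ennreal_le_coe_ennreal_iff.2
          (ofReal_labelProb_le_lintegral P ηhat hη hT M K hcont hnn hconv)
    _ = eintegral P.fst fun x => ((A x + (c + c') : ℝ) : EReal) := by
        rw [eintegral_add_coe (B := fun _ => c + c') hAnn hAm (integrable_const _)]
        simp
    _ ≤ eintegral P.fst fun x => fDiv f (condTW P ηhat hη T x) (condTWt P ηhat hη T x) := by
        refine eintegral_mono_ae ?_
        filter_upwards [hA.ae_absolutelyContinuous P ηhat hη hT] with x ⟨h1, h2, _, h4, h5⟩
        have hS : Measurable fun w => T (x, w) := hT.comp (by fun_prop)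
        have := Measure.isProbabilityMeasure_map (μ := unif01) hS.aemeasurable
        have := Measure.isProbabilityMeasure_map (μ := condW P ηhat hη x) hS.aemeasurable
        rw [h1, h2, fDiv_eq_divEnergy_add hcont hnn hf _ _ (h5.map hS) h4, EReal.coe_add]
        gcongr
        have key := sum_ofReal_condLabelProb_le P ηhat hη hT hKL hcont hnn hconv h4 (h5.map hS)
        rw [← max_eq_left (hAnn x), ← EReal.coe_ennreal_ofReal,
          EReal.coe_ennreal_le_coe_ennreal_iff, hAdef, ofReal_inv_mul_sum hnn]
        rw [mul_comm, ← div_eq_mul_inv]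
        exact ENNReal.div_le_of_le_mul' key

lemma eintegral_fDiv_score_le (hT : Measurable T) {f : ℝ → ℝ}
    (hfconv : ConvexOn ℝ (Set.Ici 0) f) (hfcont : ContinuousOn f (Set.Ici 0))
    (hA : ScoreAssumption P ηhat hη T) :
    eintegral P.fst (fun x => fDiv f (condTW P ηhat hη T x) (condTWt P ηhat hη T x)) ≤
      eintegral P.fst fun x => fDiv f (condW P ηhat hη x) (condWt P ηhat hη x) := by
  obtain ⟨h, c, c', hcont, hnn, hconv, hf⟩ := exists_nonneg_add_affine hfconv hfcont
  refine eintegral_mono_ae ?_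
  filter_upwards [hA.ae_absolutelyContinuous P ηhat hη hT] with x ⟨h1, h2, h3, h4, h5⟩
  have hS : Measurable fun w => T (x, w) := hT.comp (by fun_prop)
  have := Measure.isProbabilityMeasure_map (μ := unif01) hS.aemeasurable
  have := Measure.isProbabilityMeasure_map (μ := condW P ηhat hη x) hS.aemeasurable
  rw [h1, h2, h3, fDiv_eq_divEnergy_add hcont hnn hf _ _ (h5.map hS) h4,
    fDiv_eq_divEnergy_add hcont hnn hf _ _ h5 Measure.AbsolutelyContinuous.rfl]
  gcongr
  exact EReal.coe_ennreal_le_coe_ennreal_iff.2 (divEnergy_map_le hcont hnn hconv _ _ h5 hS)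

lemma eintegral_fDiv_condWt_eq (f : ℝ → ℝ) :
    eintegral P.fst (fun x => fDiv f (condW P ηhat hη x) (condWt P ηhat hη x)) =
      eintegral P.fst fun x => fDiv f (condW P ηhat hη x) unif01 := by
  refine eintegral_congr_ae ?_
  filter_upwards [condWt_ae_eq P ηhat hη] with x hx
  rw [hx]

end Main

end Grasp

theorem mainTheorem5 {𝒳 : Type*} [MeasurableSpace 𝒳]
    (P : Measure (𝒳 × Bool)) [IsProbabilityMeasure P]
    (ηhat : 𝒳 → unitInterval) (hη : Measurable ηhat)
    (T : 𝒳 × unitInterval → ℝ) (hT : Measurable T)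
    (n M K L : ℕ) (hKL : M + 1 = K * L)
    {Ω : Type*} [MeasurableSpace Ω] (μ : Measure Ω) [IsProbabilityMeasure μ]
    (X : Fin n → Ω → 𝒳) (Y : Fin n → Ω → Bool) (W : Fin n → Ω → unitInterval)
    (Wt : Fin n → Fin M → Ω → unitInterval)
    (hlaw : ∀ j, HasLaw (fun ω => (((X j ω, Y j ω), W j ω), fun i => Wt j i ω))
      (Grasp.sampleLaw P ηhat hη M) μ)
    (hindep : iIndepFun (fun j ω => (((X j ω, Y j ω), W j ω), fun i => Wt j i ω)) μ)
    (f : ℝ → ℝ) (hfconv : ConvexOn ℝ (Set.Ici 0) f) (hfcont : ContinuousOn f (Set.Ici 0)) :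
    let p : Fin L → ℝ := fun ℓ => Grasp.labelProb P ηhat hη T M K ℓ
    let V : Ω → Fin L → ℕ := fun ω =>
      Grasp.labelCounts T K L (fun j => X j ω) (fun j => W j ω) (fun j i => Wt j i ω)
    ((∀ ℓ, 0 ≤ p ℓ) ∧ ∑ ℓ, p ℓ = 1 ∧ HasLaw V (Grasp.multinomialLaw n p) μ) ∧
    (Grasp.ScoreAssumption P ηhat hη T →
      (((1 / (L : ℝ)) * ∑ ℓ, f (L * p ℓ) : ℝ) : EReal) ≤
          Grasp.eintegral P.fst (fun x =>
            Grasp.fDiv f (Grasp.condTW P ηhat hη T x) (Grasp.condTWt P ηhat hη T x)) ∧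
        Grasp.eintegral P.fst (fun x =>
            Grasp.fDiv f (Grasp.condTW P ηhat hη T x) (Grasp.condTWt P ηhat hη T x)) ≤
          Grasp.eintegral P.fst (fun x =>
            Grasp.fDiv f (Grasp.condW P ηhat hη x) (Grasp.condWt P ηhat hη x)) ∧
        Grasp.eintegral P.fst (fun x =>
            Grasp.fDiv f (Grasp.condW P ηhat hη x) (Grasp.condWt P ηhat hη x)) =
          Grasp.eintegral P.fst (fun x =>
            Grasp.fDiv f (Grasp.condW P ηhat hη x) Grasp.unif01)) := by
  intro p V
  refine ⟨⟨fun _ => measureReal_nonneg, Grasp.sum_labelProb P ηhat hη hKL hT,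
    Grasp.hasLaw_labelCounts P ηhat hη hKL hT hlaw hindep⟩, fun hA => ⟨?_, ?_, ?_⟩⟩
  · exact Grasp.le_eintegral_fDiv_score P ηhat hη hT hKL hfconv hfcont hA
  · exact Grasp.eintegral_fDiv_score_le P ηhat hη hT hfconv hfcont hA
  · exact Grasp.eintegral_fDiv_condWt_eq P ηhat hη f
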